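/- Let $n\ge 3$ and $[n+1]=\{1,\dots,n+1\}$. A cyclically ordered partition of $[n+1]$ is a partition of $[n+1]$ into non-empty parts together with a cyclic order of the parts, i.e. a string $(I_1,\dots,I_m)$ of parts up to cyclic rotation. Such a partition $\mu$ refines $\lambda=(I_1,\dots,I_m)$ if, for a suitable cutting, $\mu$ is obtained from the string $(I_1,\dots,I_m)$ by replacing each $I_j$ by a linearly ordered partition of $I_j$. A regular cell complex is a finite (Hausdorff) CW complex in which the characteristic map of each closed $k$-cell is a homeomorphism from the closed $k$-ball onto the closed cell, the image of the boundary sphere being a subcomplex of the $(k-1)$-skeleton. A complex $CP_{n+1}$ is a regular cell complex whose $k$-cells, for each $k$, are labeled bijectively by the cyclically ordered partitions of $[n+1]$ into $n+1-k$ non-empty parts, where $n+1-k\ge 3$ (so $0\le k\le n-2$, and there are no other cells), and in which a closed cell $F$ contains a closed cell $F'$ if and only if the label of $F'$ refines the label of $F$. Then: 1. (Existence) A complex $CP_{n+1}$ exists. 2. (Uniqueness) Any two complexes $CP_{n+1}$ are homeomorphic by a homeomorphism that maps, for each label $\lambda$, the closed cell labeled by $\lambda$ onto the closed cell labeled by $\lambda$.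 3. In any complex $CP_{n+1}$, each closed cell is combinatorially equivalent to a product of permutohedra: if the cell is labeled by $(I_1,\dots,I_m)$, then the poset (under inclusion) of the closed cells contained in it, including itself, is isomorphic to the poset of non-empty faces, including the polytope itself, of $\Pi_{|I_1|}\times\dots\times\Pi_{|I_m|}$, where $\Pi_r\subset\mathbb R^r$ is the convex hull of all the points obtained by permuting the coordinates of $(1,2,\dots,r)$. (Consequently its boundary subcomplex corresponds to the boundary complex of this product.) -/

import Mathlib

/-- A cyclically ordered partition of `α`: a cyclic string `(I₁, …, I_m)` (a list up to rotation)
of pairwise different non-empty finite sets such that every element of `α` lies in exactly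
one of them. -/
structure CyclicPartition (α : Type*) where
  /-- The cyclic string of parts. -/
  parts : Cycle (Finset α)
  nodup : parts.Nodup
  nonempty : ∀ I ∈ parts, I.Nonempty
  existsUnique : ∀ a : α, ∃! I : Finset α, I ∈ parts ∧ a ∈ I

/-- The number of parts. -/
def CyclicPartition.numParts {α : Type*} (p : CyclicPartition α) : ℕ :=
  p.parts.length

/-- `q.Refines p`: the cyclically ordered partition `q` is an (orientation preserving) refinement
of `p`. After cutting both cycles at suitable places, the string of `q` is a concatenation of
consecutive strings `L₁, …, L_m`, and the parts of `p` are, in the same order, the union of the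
sets in `L₁`, …, the union of the sets in `L_m`. -/
def CyclicPartition.Refines {α : Type*} [DecidableEq α] (q p : CyclicPartition α) : Prop :=
  ∃ L : List (List (Finset α)),
    q.parts = (L.flatten : Cycle (Finset α)) ∧
    p.parts = (L.map (fun B => B.foldr (· ∪ ·) ∅) : Cycle (Finset α))

/-- The labels of the `k`-cells of `CP_{n+1}`: cyclically ordered partitions of a set with `n + 1`
elements into `n + 1 - k` non-empty parts, where there are at least three parts. -/
def CPLabel (n k : ℕ) : Type :=
  {p : CyclicPartition (Fin (n + 1)) // 3 ≤ p.numParts ∧ p.numParts + k = n + 1}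

/-- A (finite) regular cell complex: a Hausdorff space with a finite CW structure such that the
characteristic map of every cell is injective on the closed ball (hence a homeomorphism onto
the closed cell), and the boundary of every `k`-cell is a union of closed cells of
dimension less than `k`, that is, a subcomplex of the `(k - 1)`-skeleton. -/
structure IsRegularCellComplex (X : Type*) [TopologicalSpace X]
    [Topology.CWComplex (Set.univ : Set X)] : Prop where
  t2 : T2Space X
  finite : Finite (Σ k : ℕ, Topology.RelCWComplex.cell (Set.univ : Set X) k)
  injOn : ∀ (k : ℕ) (i : Topology.RelCWComplex.cell (Set.univ : Set X) k),
    Set.InjOn (Topology.RelCWComplex.map k i) (Metric.closedBall 0 1)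
  frontier_eq : ∀ (k : ℕ) (i : Topology.RelCWComplex.cell (Set.univ : Set X) k),
    ∃ J : Set (Σ m : ℕ, Topology.RelCWComplex.cell (Set.univ : Set X) m),
      (∀ p ∈ J, p.1 < k) ∧
      Topology.RelCWComplex.cellFrontier k i =
        ⋃ p ∈ J, Topology.RelCWComplex.closedCell p.1 p.2

/-- The data exhibiting a cell complex `X` as a complex `CP_{n+1}`: `X` is a regular cell complex,
its `k`-cells are labeled bijectively by the cyclically ordered partitions of an
`(n + 1)`-element set into `n + 1 - k ≥ 3` parts, and a closed cell contains another one if and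
only if the label of the latter refines the label of the former. -/
structure CPComplex (n : ℕ) (X : Type*) [TopologicalSpace X]
    [Topology.CWComplex (Set.univ : Set X)] where
  regular : IsRegularCellComplex X
  /-- The labeling of the `k`-cells. -/
  label (k : ℕ) : Topology.RelCWComplex.cell (Set.univ : Set X) k ≃ CPLabel n k
  incidence : ∀ (k l : ℕ) (i : Topology.RelCWComplex.cell (Set.univ : Set X) k)
    (j : Topology.RelCWComplex.cell (Set.univ : Set X) l),
    Topology.RelCWComplex.closedCell l j ⊆ Topology.RelCWComplex.closedCell k i ↔
      (label l j).1.Refines (label k i).1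

/-- The closed cell with a given label. -/
def CPComplex.closedCell {n : ℕ} {X : Type*} [TopologicalSpace X]
    [Topology.CWComplex (Set.univ : Set X)] (K : CPComplex n X) {k : ℕ} (p : CPLabel n k) :
    Set X :=
  Topology.RelCWComplex.closedCell k ((K.label k).symm p)

/-- The standard permutohedron `Π_m ⊆ ℝ^m`: the convex hull of all points obtained by permuting
the coordinates of `(1, 2, …, m)`. -/
def permutohedron (m : ℕ) : Set (Fin m → ℝ) :=
  convexHull ℝ (Set.range fun (σ : Equiv.Perm (Fin m)) (i : Fin m) => ((σ i : ℕ) : ℝ) + 1)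

/-- The Cartesian product `Π_{m₁} × … × Π_{m_r}` of standard permutohedra. -/
def permutohedronProd {r : ℕ} (m : Fin r → ℕ) : Set (∀ j : Fin r, Fin (m j) → ℝ) :=
  Set.univ.pi fun j => permutohedron (m j)

/-- The non-empty faces of a polytope `P` (including `P` itself), ordered by inclusion: the sets of
maximum points on `P` of continuous linear functionals. -/
abbrev Faces {E : Type*} [AddCommGroup E] [TopologicalSpace E] [Module ℝ E] (P : Set E) : Type _ :=
  {F : Set E // F.Nonempty ∧ IsExposed ℝ P F}

/-- The closed cells of `K` contained in the closed cell labeled by `p` (including that cell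
itself), ordered by inclusion. -/
abbrev CPComplex.CellsIn {n : ℕ} {X : Type*} [TopologicalSpace X]
    [Topology.CWComplex (Set.univ : Set X)] (K : CPComplex n X) {k : ℕ} (p : CPLabel n k) :
    Type _ :=
  {S : Set X // (∃ (l : ℕ) (q : CPLabel n l), S = K.closedCell q) ∧ S ⊆ K.closedCell p}

/-! Cutting a cyclic string open turns refinement into a linear notion. A linearly ordered partition
is the same as a total preorder, and splitting its parts further means passing to a smaller relation
(`OrdersBy.le_of_flatten`, `OrdersBy.exists_flatten`). If the cyclic partition has at least two
parts, a refinement can be cut compatibly in only one way (`OrdersBy.eq_of_isRotated`). Hence the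
refinements of `(I_1, ..., I_m)` form the poset of total preorders below the preorder `s` of the cut
string (`CyclicPartition.refinementIso`).

Combinatorial type: by the rearrangement inequality a vertex of a permutohedron maximizes the
functional `c` exactly when its permutation sorts `c`, so a face depends only on the preorder
induced by `c`. A functional on the product is one functional per part, and these together amount to
a total preorder below `s` (`facesIso`).

Uniqueness: a regular complex is determined by its face poset. A homeomorphism is built cell by cell
in an order compatible with inclusion, each step extending from a sphere to a ball by the Alexander
trick (`IsBallComplex.exists_homeomorph`).

Existence: the space is the order complex of the poset of labels, the closed cell of `a` being the
union of the simplices on chains below `a`. It must be a ball (`IsFlagLabeling.exists_chart`).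
Labels below `a` correspond, with order reversed, to chains of non-empty proper subsets containing
the flag `G a` of upper sets of `s`. A point `t` yields weights `w S = ∑ t q`, over the `q` with `S
∈ G q`, for `S ∉ G a`; these determine `t`, and their maximum is `1 - t a`. Summing the indicators
of the `S` with weights `w S`, modulo functions constant on the parts, identifies all admissible
weights with a Euclidean space: this is the complete fan of a product of braid arrangements. The
cell becomes the star-shaped region where all weights are at most `1`, and radial rescaling makes it
the unit ball, with boundary `t a = 0`. -/

section OrderedPartitions

/-! ### Linearly ordered partitions as total preorders -/

variable {α : Type*}

/-- The total preorders on `α`, ordered by inclusion of relations. -/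
abbrev TotalPreorder (α : Type*) : Type _ :=
  {r : α → α → Prop // (∀ i j, r i j ∨ r j i) ∧ ∀ i j k, r i j → r j k → r i k}

theorem TotalPreorder.refl (r : TotalPreorder α) (i : α) : r.1 i i := by
  rcases r.2.1 i i with h | h <;> exact h

/-- The list `w` of sets consists of the classes of the relation `r`, in increasing order. -/
structure OrdersBy (w : List (Finset α)) (r : α → α → Prop) : Prop where
  nonempty : ∀ A ∈ w, A.Nonempty
  cover : ∀ i, ∃ A ∈ w, i ∈ A
  tied : ∀ A ∈ w, ∀ i ∈ A, ∀ j ∈ A, r i j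
  sorted : w.Pairwise fun A B => ∀ i ∈ A, ∀ j ∈ B, r i j ∧ ¬ r j i

theorem List.Pairwise.trichotomy {β : Type*} {R : β → β → Prop} {l : List β} (h : l.Pairwise R)
    {a b : β} (ha : a ∈ l) (hb : b ∈ l) : a = b ∨ R a b ∨ R b a := by
  have : Std.Symm fun a b => a = b ∨ R a b ∨ R b a := ⟨by
    rintro x y (h | h | h)
    · exact Or.inl h.symm
    · exact Or.inr (Or.inr h)
    · exact Or.inr (Or.inl h)⟩
  exact List.Pairwise.forall_of_forall (R := fun a b => a = b ∨ R a b ∨ R b a)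
    (fun x _ => Or.inl rfl) (h.imp fun h => Or.inr (Or.inl h)) ha hb

theorem OrdersBy.mem_iff {w : List (Finset α)} {r : α → α → Prop} (h : OrdersBy w r)
    {A : Finset α} (hA : A ∈ w) {i : α} (hi : i ∈ A) (j : α) : j ∈ A ↔ r i j ∧ r j i := by
  constructor
  · intro hj
    exact ⟨h.tied A hA i hi j hj, h.tied A hA j hj i hi⟩
  · rintro ⟨h1, h2⟩
    obtain ⟨B, hB, hjB⟩ := h.cover j
    rcases h.sorted.trichotomy hA hB with e | e | e
    · rwa [e]
    · exact absurd h2 (e i hi j hjB).2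
    · exact absurd h1 (e j hjB i hi).2

theorem OrdersBy.nodup {w : List (Finset α)} {r : α → α → Prop} (h : OrdersBy w r) : w.Nodup := by
  have := List.Pairwise.and_mem.1 h.sorted
  refine List.Pairwise.imp ?_ this
  rintro A B ⟨hA, -, hAB⟩ rfl
  obtain ⟨i, hi⟩ := h.nonempty A hA
  exact (hAB i hi i hi).2 (hAB i hi i hi).1

theorem OrdersBy.unique {w w' : List (Finset α)} {r : α → α → Prop} (h : OrdersBy w r)
    (h' : OrdersBy w' r) : w = w' := by
  have key : ∀ {w w' : List (Finset α)}, OrdersBy w r → OrdersBy w' r → ∀ A ∈ w, A ∈ w' := by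
    intro w w' h h' A hA
    obtain ⟨i, hi⟩ := h.nonempty A hA
    obtain ⟨B, hB, hiB⟩ := h'.cover i
    have : A = B := by
      ext j
      rw [h.mem_iff hA hi, h'.mem_iff hB hiB]
    rwa [this]
  have hp : w.Perm w' := (List.perm_ext_iff_of_nodup h.nodup h'.nodup).2
    fun A => ⟨key h h' A, key h' h A⟩
  refine hp.eq_of_pairwise ?_ h.sorted h'.sorted
  intro A B hA _ hAB hBA
  obtain ⟨i, hi⟩ := h.nonempty A hA
  obtain ⟨j, hj⟩ := h'.nonempty B ‹_›
  exact absurd (hAB i hi j hj).1 (hBA j hj i hi).2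

/-- The number of elements that are at most `i`. -/
noncomputable def TotalPreorder.rank [Fintype α] (r : TotalPreorder α) (i : α) : ℕ :=
  open scoped Classical in (Finset.univ.filter fun k => r.1 k i).card

/-- A numerical function inducing `r`: its fibres list the classes, and later it supplies the
coefficients of a linear functional. -/
theorem TotalPreorder.rank_le_rank_iff [Fintype α] (r : TotalPreorder α) {i j : α} :
    r.rank i ≤ r.rank j ↔ r.1 i j := by
  classical
  constructor
  · intro h
    by_contra h'
    refine absurd h (not_le.2 ?_)
    refine Finset.card_lt_card ((Finset.ssubset_iff_of_subset fun k hk => ?_).2 ⟨i, ?_, ?_⟩)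
    · simp only [Finset.mem_filter, Finset.mem_univ, true_and] at hk ⊢
      exact r.2.2 _ _ _ hk ((r.2.1 i j).resolve_left h')
    · simpa using r.refl i
    · simpa using h'
  · intro h
    refine Finset.card_le_card fun k hk => ?_
    simp only [Finset.mem_filter, Finset.mem_univ, true_and] at hk ⊢
    exact r.2.2 _ _ _ hk h

theorem exists_ordersBy [Fintype α] (r : TotalPreorder α) : ∃ w, OrdersBy w r.1 := by
  classical
  set κ : α → ℕ := r.rank
  have iff_le : ∀ i j, r.1 i j ↔ κ i ≤ κ j := fun i j => r.rank_le_rank_iff.symm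
  -- The classes are the non-empty fibres of the rank, whose values are at most `Fintype.card α`.
  refine ⟨((List.range (Fintype.card α + 1)).map fun n => Finset.univ.filter fun i => κ i = n).filter
    fun A => A.Nonempty, ?_, ?_, ?_, ?_⟩
  · intro A hA
    simpa using (List.mem_filter.1 hA).2
  · intro i
    refine ⟨Finset.univ.filter fun j => κ j = κ i, ?_, by simp⟩
    rw [List.mem_filter]
    refine ⟨List.mem_map.2 ⟨κ i, ?_, rfl⟩, by simpa using ⟨i, by simp⟩⟩
    rw [List.mem_range, Nat.lt_succ_iff]
    rw [← Finset.card_univ]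
    exact Finset.card_le_card (Finset.filter_subset _ _)
  · intro A hA i hi j hj
    obtain ⟨n, -, rfl⟩ := List.mem_map.1 (List.mem_filter.1 hA).1
    simp only [Finset.mem_filter, Finset.mem_univ, true_and] at hi hj
    rw [iff_le, hi, hj]
  · refine List.Pairwise.filter _ (List.pairwise_map.2 (List.pairwise_lt_range.imp ?_))
    intro a b hab i hi j hj
    simp only [Finset.mem_filter, Finset.mem_univ, true_and] at hi hj
    rw [iff_le, iff_le, hi, hj]
    omega

/-- The classes of a total preorder, in increasing order. -/
noncomputable def TotalPreorder.classes [Fintype α] (r : TotalPreorder α) : List (Finset α) :=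
  (exists_ordersBy r).choose

theorem TotalPreorder.ordersBy_classes [Fintype α] (r : TotalPreorder α) :
    OrdersBy r.classes r.1 :=
  (exists_ordersBy r).choose_spec

theorem mem_foldr_union [DecidableEq α] {l : List (Finset α)} {a : α} :
    a ∈ l.foldr (· ∪ ·) ∅ ↔ ∃ A ∈ l, a ∈ A := by
  induction l with
  | nil => simp
  | cons B l ih => simp [ih]

/-- Two elements in the same block are tied for `r'`; in different blocks, both relations follow the
order of the blocks. With the converse `OrdersBy.exists_flatten`, this replaces manipulation of
strings by inclusion of relations. -/
theorem OrdersBy.le_of_flatten [DecidableEq α] {L : List (List (Finset α))} {r r' : α → α → Prop}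
    (h : OrdersBy L.flatten r) (h' : OrdersBy (L.map fun B => B.foldr (· ∪ ·) ∅) r') : r ≤ r' := by
  intro i j hij
  obtain ⟨A, hA, hi⟩ := h.cover i
  obtain ⟨B, hB, hj⟩ := h.cover j
  obtain ⟨l₁, hl₁, hA⟩ := List.mem_flatten.1 hA
  obtain ⟨l₂, hl₂, hB⟩ := List.mem_flatten.1 hB
  have h1 := (List.pairwise_flatten.1 h.sorted).2
  have h2 := List.pairwise_map.1 h'.sorted
  rcases (h1.and h2).trichotomy hl₁ hl₂ with e | e | e
  · subst e
    exact h'.tied _ (List.mem_map.2 ⟨l₁, hl₁, rfl⟩) i (mem_foldr_union.2 ⟨A, hA, hi⟩) j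
      (mem_foldr_union.2 ⟨B, hB, hj⟩)
  · exact (e.2 i (mem_foldr_union.2 ⟨A, hA, hi⟩) j (mem_foldr_union.2 ⟨B, hB, hj⟩)).1
  · exact absurd hij (e.1 B hB A hA j hj i hi).2

theorem OrdersBy.exists_flatten [DecidableEq α] {w w' : List (Finset α)} {r r' : α → α → Prop}
    (h : OrdersBy w r) (h' : OrdersBy w' r') (hr : r ≤ r') :
    ∃ L : List (List (Finset α)), L.flatten = w ∧ L.map (fun B => B.foldr (· ∪ ·) ∅) = w' := by
  have sub : ∀ B ∈ w', ∀ i ∈ B, ∀ A ∈ w, i ∈ A → A ⊆ B := by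
    intro B hB i hi A hA hiA j hj
    rw [h'.mem_iff hB hi]
    exact ⟨hr _ _ (h.tied A hA i hiA j hj), hr _ _ (h.tied A hA j hj i hiA)⟩
  -- The block over a coarse class `B` lists the fine classes inside `B`. The concatenation is again
  -- a sorted list of the classes of `r`, so it is `w` by uniqueness.
  refine ⟨w'.map fun B => w.filter (· ⊆ B), OrdersBy.unique (r := r) ⟨?_, ?_, ?_, ?_⟩ h, ?_⟩
  · intro A hA
    obtain ⟨l, hl, hA⟩ := List.mem_flatten.1 hA
    obtain ⟨B, -, rfl⟩ := List.mem_map.1 hl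
    exact h.nonempty A (List.mem_filter.1 hA).1
  · intro i
    obtain ⟨A, hA, hiA⟩ := h.cover i
    obtain ⟨B, hB, hiB⟩ := h'.cover i
    refine ⟨A, List.mem_flatten.2 ⟨_, List.mem_map.2 ⟨B, hB, rfl⟩, List.mem_filter.2 ⟨hA, ?_⟩⟩, hiA⟩
    simpa using sub B hB i hiB A hA hiA
  · intro A hA
    obtain ⟨l, hl, hA⟩ := List.mem_flatten.1 hA
    obtain ⟨B, -, rfl⟩ := List.mem_map.1 hl
    exact h.tied A (List.mem_filter.1 hA).1
  · rw [List.pairwise_flatten]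
    constructor
    · intro l hl
      obtain ⟨B, -, rfl⟩ := List.mem_map.1 hl
      exact h.sorted.filter _
    · rw [List.pairwise_map]
      refine h'.sorted.imp ?_
      intro B C hBC A hA A' hA' i hi j hj
      have hA := List.mem_filter.1 hA
      have hA' := List.mem_filter.1 hA'
      have := hBC i ((by simpa using hA.2 : A ⊆ B) hi) j ((by simpa using hA'.2 : A' ⊆ C) hj)
      rcases h.sorted.trichotomy hA.1 hA'.1 with e | e | e
      · subst e
        exact absurd (hr _ _ (h.tied A hA.1 j hj i hi)) this.2
      · exact e i hi j hj
      · exact absurd (hr _ _ (e j hj i hi).1) this.2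
  · rw [List.map_map]
    conv_rhs => rw [← List.map_id w']
    refine List.map_congr_left fun B hB => ?_
    ext i
    simp only [Function.comp, mem_foldr_union, List.mem_filter, decide_eq_true_eq, id]
    constructor
    · rintro ⟨A, ⟨-, hAB⟩, hi⟩
      exact hAB hi
    · intro hi
      obtain ⟨A, hA, hiA⟩ := h.cover i
      exact ⟨A, ⟨hA, sub B hB i hi A hA hiA⟩, hiA⟩

/-- If `u ++ v` and `v ++ u` with `u`, `v` non-empty both refined `s`, every element of `u` would be
tied in `s` with every element of `v`, and so `s` would have a single class. -/
theorem OrdersBy.eq_of_isRotated {w w' : List (Finset α)} {r r' s : α → α → Prop}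
    (h : OrdersBy w r) (h' : OrdersBy w' r') (hr : r ≤ s) (hr' : r' ≤ s)
    (hs : ∀ i j k, s i j → s j k → s i k) (hne : ∃ i j, ¬ s i j) (hw : w ~r w') : w = w' := by
  obtain ⟨n, hn, rfl⟩ := List.isRotated_iff_mod.1 hw
  rw [List.rotate_eq_drop_append_take hn] at h' ⊢
  set u := w.take n
  set v := w.drop n
  have hwuv : w = u ++ v := (List.take_append_drop n w).symm
  rw [hwuv] at h ⊢
  by_cases hu : u = []
  · simp [hu]
  by_cases hv : v = []
  · simp [hv]
  exfalso
  obtain ⟨A, hA⟩ := List.exists_mem_of_ne_nil u hu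
  obtain ⟨B, hB⟩ := List.exists_mem_of_ne_nil v hv
  have h1 : ∀ A ∈ u, ∀ B ∈ v, ∀ i ∈ A, ∀ j ∈ B, s i j ∧ s j i := by
    intro A hA B hB i hi j hj
    exact ⟨hr _ _ ((List.pairwise_append.1 h.sorted).2.2 A hA B hB i hi j hj).1,
      hr' _ _ ((List.pairwise_append.1 h'.sorted).2.2 B hB A hA j hj i hi).1⟩
  obtain ⟨a, ha⟩ := h.nonempty A (by simp [hA])
  obtain ⟨b, hb⟩ := h.nonempty B (by simp [hB])
  have h2 : ∀ i, s i b ∧ s b i := by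
    intro i
    obtain ⟨C, hC, hi⟩ := h.cover i
    rcases List.mem_append.1 hC with hC | hC
    · exact h1 C hC B hB i hi b hb
    · have e1 := h1 A hA C hC a ha i hi
      have e2 := h1 A hA B hB a ha b hb
      exact ⟨hs _ _ _ e1.2 e2.1, hs _ _ _ e2.2 e1.1⟩
  obtain ⟨i, j, hij⟩ := hne
  exact hij (hs _ _ _ (h2 i).1 (h2 j).2)

end OrderedPartitions

/-! ### Cyclic partitions, refinement, and cutting open -/

section CyclicPartitions

variable {α : Type*}

theorem CyclicPartition.ext_parts {p q : CyclicPartition α} (h : p.parts = q.parts) : p = q := by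
  cases p
  cases q
  simpa using h

theorem CyclicPartition.exists_coe_eq (p : CyclicPartition α) :
    ∃ w : List (Finset α), p.parts = (w : Cycle (Finset α)) := by
  obtain ⟨w, hw⟩ := Quotient.exists_rep p.parts
  exact ⟨w, hw.symm⟩

theorem CyclicPartition.exists_ordersBy (p : CyclicPartition α) {w : List (Finset α)}
    (hw : p.parts = (w : Cycle (Finset α))) : ∃ r : TotalPreorder α, OrdersBy w r.1 := by
  have hnd : w.Nodup := by
    have := p.nodup
    rwa [hw, Cycle.nodup_coe_iff] at this
  have hne : ∀ A ∈ w, A.Nonempty := fun A hA => p.nonempty A (by rwa [hw, Cycle.mem_coe_iff])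
  have hex : ∀ a, ∃ k : Fin w.length, a ∈ w.get k := by
    intro a
    obtain ⟨A, ⟨hA, ha⟩, -⟩ := p.existsUnique a
    rw [hw, Cycle.mem_coe_iff] at hA
    obtain ⟨k, rfl⟩ := List.get_of_mem hA
    exact ⟨k, ha⟩
  choose f hf using hex
  have huniq : ∀ a k, a ∈ w.get k → k = f a := by
    intro a k hk
    obtain ⟨A, -, hA⟩ := p.existsUnique a
    rw [hw] at hA
    have h1 := hA (w.get k) ⟨Cycle.mem_coe_iff.2 (List.get_mem _ _), hk⟩
    have h2 := hA (w.get (f a)) ⟨Cycle.mem_coe_iff.2 (List.get_mem _ _), hf a⟩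
    exact (List.nodup_iff_injective_get.1 hnd) (h1.trans h2.symm)
  refine ⟨⟨fun i j => f i ≤ f j, fun i j => le_total _ _, fun i j k => le_trans⟩, hne,
    fun i => ⟨w.get (f i), List.get_mem _ _, hf i⟩, ?_, ?_⟩
  · intro A hA i hi j hj
    obtain ⟨k, rfl⟩ := List.get_of_mem hA
    exact ((huniq i k hi).symm.trans (huniq j k hj)).le
  · rw [List.pairwise_iff_get]
    intro a b hab i hi j hj
    have h : f i < f j := by rwa [← huniq i a hi, ← huniq j b hj]
    exact ⟨h.le, not_le.2 h⟩

/-- The cyclically ordered partition obtained by closing up a linearly ordered one. -/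
def OrdersBy.toCyclicPartition {w : List (Finset α)} {r : α → α → Prop} (h : OrdersBy w r) :
    CyclicPartition α where
  parts := w
  nodup := Cycle.nodup_coe_iff.2 h.nodup
  nonempty A hA := h.nonempty A (Cycle.mem_coe_iff.1 hA)
  existsUnique a := by
    obtain ⟨A, hA, ha⟩ := h.cover a
    refine ⟨A, ⟨Cycle.mem_coe_iff.2 hA, ha⟩, ?_⟩
    rintro B ⟨hB, hb⟩
    ext j
    rw [h.mem_iff hA ha, h.mem_iff (Cycle.mem_coe_iff.1 hB) hb]

theorem OrdersBy.exists_index {w : List (Finset α)} {r : α → α → Prop} (h : OrdersBy w r) :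
    ∃ b : α → Fin w.length, (∀ i j, i ∈ w.get j ↔ b i = j) ∧ ∀ i j, r i j ↔ b i ≤ b j := by
  have hex : ∀ i, ∃ k : Fin w.length, i ∈ w.get k := by
    intro i
    obtain ⟨A, hA, hi⟩ := h.cover i
    obtain ⟨k, rfl⟩ := List.get_of_mem hA
    exact ⟨k, hi⟩
  choose b hb using hex
  have hs := List.pairwise_iff_get.1 h.sorted
  refine ⟨b, fun i j => ⟨fun hi => ?_, fun hi => hi ▸ hb i⟩, fun i j => ⟨fun hij => ?_, fun hij => ?_⟩⟩
  · refine List.nodup_iff_injective_get.1 h.nodup ?_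
    ext k
    rw [h.mem_iff (List.get_mem _ _) (hb i), h.mem_iff (List.get_mem _ _) hi]
  · by_contra hlt
    exact (hs _ _ (not_le.1 hlt) j (hb j) i (hb i)).2 hij
  · rcases hij.eq_or_lt with e | e
    · exact h.tied _ (List.get_mem w (b i)) i (hb i) j (by rw [e]; exact hb j)
    · exact (hs _ _ e i (hb i) j (hb j)).1

theorem OrdersBy.exists_not_rel {w : List (Finset α)} {r : α → α → Prop} (h : OrdersBy w r)
    (hw : 2 ≤ w.length) : ∃ i j, ¬ r i j := by
  match w, hw with
  | A :: B :: l, _ =>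
    obtain ⟨i, hi⟩ := h.nonempty A (by simp)
    obtain ⟨j, hj⟩ := h.nonempty B (by simp)
    exact ⟨j, i, ((List.pairwise_cons.1 h.sorted).1 B (by simp) i hi j hj).2⟩

theorem OrdersBy.length_le_card [Fintype α] {w : List (Finset α)} {r : α → α → Prop}
    (h : OrdersBy w r) : w.length ≤ Fintype.card α := by
  have hex : ∀ k : Fin w.length, ∃ i, i ∈ w.get k := fun k => h.nonempty _ (List.get_mem _ _)
  choose f hf using hex
  have hinj : Function.Injective f := by
    intro a b hab
    refine List.nodup_iff_injective_get.1 h.nodup ?_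
    ext j
    rw [h.mem_iff (List.get_mem _ _) (hf a), h.mem_iff (List.get_mem _ _) (hf b), hab]
  simpa using Fintype.card_le_of_injective f hinj

theorem CyclicPartition.numParts_le_card [Fintype α] (p : CyclicPartition α) :
    p.numParts ≤ Fintype.card α := by
  obtain ⟨w, hw⟩ := p.exists_coe_eq
  obtain ⟨r, hr⟩ := p.exists_ordersBy hw
  rw [CyclicPartition.numParts, hw, Cycle.length_coe]
  exact hr.length_le_card

variable [DecidableEq α]

/-- The place where `p` is cut may be prescribed: rotating the list of blocks only rotates its
concatenation. -/
theorem CyclicPartition.Refines.exists_flatten {q p : CyclicPartition α} (h : q.Refines p)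
    {I : List (Finset α)} (hI : p.parts = (I : Cycle (Finset α))) :
    ∃ L : List (List (Finset α)), q.parts = (L.flatten : Cycle (Finset α)) ∧
      L.map (fun B => B.foldr (· ∪ ·) ∅) = I := by
  obtain ⟨L, h1, h2⟩ := h
  rw [hI, Cycle.coe_eq_coe] at h2
  obtain ⟨n, hn⟩ := h2.symm
  refine ⟨L.rotate n, ?_, by rw [List.map_rotate, hn]⟩
  rw [h1, Cycle.coe_eq_coe]
  obtain ⟨m, hm, hm'⟩ := List.isRotated_iff_mod.1 (⟨n, rfl⟩ : L ~r L.rotate n)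
  rw [← hm', List.rotate_eq_drop_append_take hm, List.flatten_append]
  conv_lhs => rw [← List.take_append_drop m L, List.flatten_append]
  exact List.isRotated_append

theorem CyclicPartition.Refines.trans {s q p : CyclicPartition α} (h : s.Refines q)
    (h' : q.Refines p) : s.Refines p := by
  obtain ⟨I, hI⟩ := p.exists_coe_eq
  obtain ⟨L', hq, hL'⟩ := h'.exists_flatten hI
  obtain ⟨L, hs, hL⟩ := h.exists_flatten hq
  obtain ⟨rI, hrI⟩ := p.exists_ordersBy hI
  obtain ⟨rq, hrq⟩ := q.exists_ordersBy hq
  obtain ⟨rs, hrs⟩ := s.exists_ordersBy hs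
  have h1 : rs.1 ≤ rq.1 := hrs.le_of_flatten (by rwa [hL])
  have h2 : rq.1 ≤ rI.1 := hrq.le_of_flatten (by rwa [hL'])
  obtain ⟨M, hM, hM'⟩ := hrs.exists_flatten hrI (h1.trans h2)
  exact ⟨M, by rw [hM, hs], by rw [hM', hI]⟩

theorem CyclicPartition.Refines.refl (p : CyclicPartition α) : p.Refines p := by
  obtain ⟨I, hI⟩ := p.exists_coe_eq
  obtain ⟨rI, hrI⟩ := p.exists_ordersBy hI
  obtain ⟨M, hM, hM'⟩ := hrI.exists_flatten hrI le_rfl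
  exact ⟨M, by rw [hM, hI], by rw [hM', hI]⟩

/-- The blocks are non-empty, so the concatenation is longer than the list of blocks unless every
block is a single set. This gives antisymmetry of refinement and strict monotonicity of dimension.
-/
theorem CyclicPartition.Refines.eq_or_lt {q p : CyclicPartition α} (h : q.Refines p) :
    q = p ∨ p.numParts < q.numParts := by
  obtain ⟨I, hI⟩ := p.exists_coe_eq
  obtain ⟨L, hq, hL⟩ := h.exists_flatten hI
  have hne : ∀ l ∈ L, l ≠ [] := by
    rintro l hl rfl
    have := p.nonempty ∅ (by
      rw [hI, Cycle.mem_coe_iff, ← hL]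
      exact List.mem_map.2 ⟨[], hl, rfl⟩)
    simp at this
  have key : ∀ L : List (List (Finset α)), (∀ l ∈ L, l ≠ []) →
      L.flatten = L.map (fun B => B.foldr (· ∪ ·) ∅) ∨ L.length < L.flatten.length := by
    intro L
    induction L with
    | nil => simp
    | cons l L ih =>
      intro hne
      match l, hne l (by simp) with
      | [A], _ =>
        rcases ih fun l hl => hne l (by simp [hl]) with h | h
        · left
          simp [h]
        · right
          simpa using h
      | A :: B :: l, _ =>
        right
        have : L.length ≤ L.flatten.length := by
          rcases ih fun l hl => hne l (by simp [hl]) with h | h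
          · simp [h]
          · exact h.le
        simp only [List.length_cons, List.flatten_cons, List.length_append]
        omega
  rcases key L hne with h | h
  · left
    apply CyclicPartition.ext_parts
    rw [hq, h, hL, hI]
  · right
    rw [CyclicPartition.numParts, CyclicPartition.numParts, hI, hq, Cycle.length_coe,
      Cycle.length_coe, ← hL, List.length_map]
    exact h

/-- Cyclically ordered partitions are ordered by refinement, finer ones being smaller. -/
instance : PartialOrder (CyclicPartition α) where
  le := CyclicPartition.Refines
  le_refl := CyclicPartition.Refines.refl
  le_trans _ _ _ := CyclicPartition.Refines.trans
  le_antisymm p q h h' := by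
    rcases h.eq_or_lt with e | e
    · exact e
    · rcases h'.eq_or_lt with e' | e'
      · exact e'.symm
      · exact absurd e (lt_asymm e')

theorem CyclicPartition.numParts_lt_of_lt {q p : CyclicPartition α} (h : q < p) :
    p.numParts < q.numParts :=
  (CyclicPartition.Refines.eq_or_lt h.le).resolve_left h.ne

instance [Finite α] : Finite (CyclicPartition α) := by
  have := Fintype.ofFinite α
  classical
  exact Finite.of_injective
    (fun p : CyclicPartition α => (⟨p.parts, p.nodup⟩ : {s : Cycle (Finset α) // s.Nodup}))
    fun p q h => CyclicPartition.ext_parts (congrArg Subtype.val h)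

/-- Cutting a cyclically ordered partition `p` open identifies its refinements with the total
preorders refining the resulting linear order of the parts. -/
noncomputable def CyclicPartition.refinementIso [Fintype α] {p : CyclicPartition α}
    {I : List (Finset α)} (hI : p.parts = (I : Cycle (Finset α))) (h2 : 2 ≤ I.length)
    {s : TotalPreorder α} (hs : OrdersBy I s.1) :
    {r : TotalPreorder α // r ≤ s} ≃o {q : CyclicPartition α // q ≤ p} :=
  RelIso.ofSurjective
    (OrderEmbedding.ofMapLEIff
      (fun r => ⟨r.1.ordersBy_classes.toCyclicPartition, by
        obtain ⟨L, hL, hL'⟩ := r.1.ordersBy_classes.exists_flatten hs r.2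
        exact ⟨L, by rw [hL]; rfl, by rw [hL', hI]⟩⟩)
      (by
        intro r r'
        constructor
        · intro h
          obtain ⟨L, hL, hL'⟩ := CyclicPartition.Refines.exists_flatten h
            (I := r'.1.classes) rfl
          obtain ⟨t, ht⟩ := CyclicPartition.exists_ordersBy _ hL
          have htr : t.1 ≤ r'.1.1 := ht.le_of_flatten (by rw [hL']; exact r'.1.ordersBy_classes)
          -- The hypothesis only gives equality up to rotation; since both strings refine `s`, which
          -- has at least two classes, the rotation is trivial.
          have e : r.1.classes = L.flatten := r.1.ordersBy_classes.eq_of_isRotated ht r.2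
            (htr.trans r'.2) s.2.2 (hs.exists_not_rel h2) (Cycle.coe_eq_coe.1 hL)
          have h3 := r.1.ordersBy_classes
          rw [e] at h3
          exact h3.le_of_flatten (by rw [hL']; exact r'.1.ordersBy_classes)
        · intro h
          obtain ⟨L, hL, hL'⟩ := r.1.ordersBy_classes.exists_flatten r'.1.ordersBy_classes h
          exact ⟨L, by rw [hL]; rfl, by rw [hL']; rfl⟩))
    (by
      rintro ⟨q, hq⟩
      obtain ⟨L, hL, hL'⟩ := CyclicPartition.Refines.exists_flatten hq hI
      obtain ⟨t, ht⟩ := q.exists_ordersBy hL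
      have hts : t.1 ≤ s.1 := ht.le_of_flatten (by rwa [hL'])
      refine ⟨⟨t, hts⟩, Subtype.ext (CyclicPartition.ext_parts ?_)⟩
      rw [hL]
      exact congrArg _ (t.ordersBy_classes.unique ht))

end CyclicPartitions

/-! ### Ball complexes and the Alexander trick -/

section BallComplexes

open Metric Set Function

/-- An injective continuous map from a compact space to a Hausdorff space is an embedding, so
continuity can be tested after composing with it. -/
theorem ContinuousOn.of_comp_of_isCompact {X Y Z : Type*} [TopologicalSpace X] [TopologicalSpace Y]
    [TopologicalSpace Z] [T2Space Y] {ψ : X → Y} {K : Set X} (hK : IsCompact K)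
    (hψ : ContinuousOn ψ K) (hi : InjOn ψ K) {h : Z → X} {S : Set Z} (hS : MapsTo h S K)
    (hc : ContinuousOn (fun z => ψ (h z)) S) : ContinuousOn h S := by
  have := isCompact_iff_compactSpace.1 hK
  have he : Topology.IsClosedEmbedding (K.domRestrict ψ) :=
    (continuousOn_iff_continuous_domRestrict.1 hψ).isClosedEmbedding (injOn_iff_injective.1 hi)
  rw [continuousOn_iff_continuous_domRestrict] at hc ⊢
  have h1 : Continuous (fun z : S => (⟨h z, hS z.2⟩ : K)) := by
    rw [he.isEmbedding.continuous_iff]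
    exact hc
  exact continuous_subtype_val.comp h1

theorem ContinuousOn.invFunOn_of_isCompact {X Y : Type*} [Nonempty X] [TopologicalSpace X]
    [TopologicalSpace Y] [T2Space Y] {ψ : X → Y} {K : Set X} (hK : IsCompact K)
    (hψ : ContinuousOn ψ K) (hi : InjOn ψ K) : ContinuousOn (invFunOn ψ K) (ψ '' K) := by
  refine ContinuousOn.of_comp_of_isCompact hK hψ hi (fun y hy => invFunOn_mem hy) ?_
  exact continuousOn_id.congr fun y hy => invFunOn_eq hy

section Radial

variable {E F : Type*} [NormedAddCommGroup E] [NormedSpace ℝ E]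
  [NormedAddCommGroup F] [NormedSpace ℝ F]

/-- The positively homogeneous extension of a map from the unit sphere. -/
noncomputable def radialExtension (h : E → F) (x : E) : F := ‖x‖ • h (‖x‖⁻¹ • x)

theorem inv_norm_smul_mem_sphere {x : E} (hx : x ≠ 0) : ‖x‖⁻¹ • x ∈ sphere (0 : E) 1 := by
  rw [mem_sphere_zero_iff_norm, norm_smul, norm_inv, norm_norm,
    inv_mul_cancel₀ (norm_ne_zero_iff.2 hx)]

theorem norm_radialExtension {h : E → F} (hm : MapsTo h (sphere 0 1) (sphere 0 1)) (x : E) :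
    ‖radialExtension h x‖ = ‖x‖ := by
  by_cases hx : x = 0
  · simp [radialExtension, hx]
  · have := hm (inv_norm_smul_mem_sphere hx)
    rw [mem_sphere_zero_iff_norm] at this
    rw [radialExtension, norm_smul, this, norm_norm, mul_one]

theorem radialExtension_of_mem_sphere (h : E → F) {x : E} (hx : x ∈ sphere (0 : E) 1) :
    radialExtension h x = h x := by
  rw [mem_sphere_zero_iff_norm] at hx
  simp [radialExtension, hx]

/-- Away from the origin the formula is continuous; at the origin preservation of the norm suffices.
-/
theorem continuous_radialExtension {h : E → F} (hc : ContinuousOn h (sphere 0 1))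
    (hm : MapsTo h (sphere 0 1) (sphere 0 1)) : Continuous (radialExtension h) := by
  rw [continuous_iff_continuousAt]
  intro x
  by_cases hx : x = 0
  · subst hx
    have h0 : radialExtension h 0 = 0 := by simp [radialExtension]
    rw [ContinuousAt, h0]
    refine squeeze_zero_norm (fun y => (norm_radialExtension hm y).le) ?_
    simpa using (continuous_norm (E := E)).tendsto 0
  · have h1 : ContinuousOn (radialExtension h) {0}ᶜ := by
      refine continuous_norm.continuousOn.smul (hc.comp ?_ fun y hy => inv_norm_smul_mem_sphere hy)
      exact (continuous_norm.continuousOn.inv₀ fun y hy => norm_ne_zero_iff.2 hy).smul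
        continuousOn_id
    exact h1.continuousAt (isOpen_compl_singleton.mem_nhds hx)

theorem injective_radialExtension {h : E → F} (hi : InjOn h (sphere 0 1))
    (hm : MapsTo h (sphere 0 1) (sphere 0 1)) : Injective (radialExtension h) := by
  intro x y hxy
  have hn : ‖x‖ = ‖y‖ := by
    rw [← norm_radialExtension hm x, hxy, norm_radialExtension hm]
  by_cases hx : x = 0
  · subst hx
    rw [norm_zero, eq_comm, norm_eq_zero] at hn
    exact hn.symm
  · have hx' := norm_ne_zero_iff.2 hx
    have hy : y ≠ 0 := norm_ne_zero_iff.1 (hn ▸ hx')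
    rw [radialExtension, radialExtension, ← hn] at hxy
    have h1 := hi (inv_norm_smul_mem_sphere hx)
      (by rw [hn]; exact inv_norm_smul_mem_sphere hy) (smul_right_injective F hx' hxy)
    exact smul_right_injective E (inv_ne_zero hx') h1

theorem surjective_radialExtension {h : E → F} (hs : SurjOn h (sphere 0 1) (sphere 0 1)) :
    Surjective (radialExtension h) := by
  intro y
  by_cases hy : y = 0
  · exact ⟨0, by simp [radialExtension, hy]⟩
  · obtain ⟨x, hx, hxy⟩ := hs (inv_norm_smul_mem_sphere hy)
    rw [mem_sphere_zero_iff_norm] at hx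
    have hy' := norm_ne_zero_iff.2 hy
    refine ⟨‖y‖ • x, ?_⟩
    rw [radialExtension, norm_smul, hx, norm_norm, mul_one, smul_smul, inv_mul_cancel₀ hy',
      one_smul, hxy, smul_smul, mul_inv_cancel₀ hy', one_smul]

end Radial

/-- The Alexander trick: an injective map between the boundaries of two embedded balls extends to
the balls. -/
theorem exists_extension_of_ball {X Y E : Type*} [TopologicalSpace X] [T2Space X]
    [TopologicalSpace Y] [T2Space Y] [NormedAddCommGroup E] [NormedSpace ℝ E]
    [FiniteDimensional ℝ E] {φ : E → X} {ψ : E → Y}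
    (hφ : ContinuousOn φ (closedBall 0 1)) (hφi : InjOn φ (closedBall 0 1))
    (hψ : ContinuousOn ψ (closedBall 0 1)) (hψi : InjOn ψ (closedBall 0 1))
    {f : X → Y} (hf : ContinuousOn f (φ '' sphere 0 1)) (hfi : InjOn f (φ '' sphere 0 1))
    (himg : f '' (φ '' sphere 0 1) = ψ '' sphere 0 1) :
    ∃ g : X → Y, ContinuousOn g (φ '' closedBall 0 1) ∧ InjOn g (φ '' closedBall 0 1) ∧
      g '' (φ '' closedBall 0 1) = ψ '' closedBall 0 1 ∧ EqOn g f (φ '' sphere 0 1) := by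
  have := FiniteDimensional.proper ℝ E
  have hss : sphere (0 : E) 1 ⊆ closedBall 0 1 := sphere_subset_closedBall
  -- On the sphere `h` is `ψ⁻¹ ∘ f ∘ φ`; its values elsewhere are irrelevant.
  have hex : ∀ x : E, ∃ y : E, x ∈ sphere (0 : E) 1 → y ∈ sphere (0 : E) 1 ∧ ψ y = f (φ x) := by
    intro x
    by_cases hx : x ∈ sphere (0 : E) 1
    · have h1 : f (φ x) ∈ ψ '' sphere 0 1 := himg ▸ mem_image_of_mem f (mem_image_of_mem φ hx)
      obtain ⟨y, hy, hyx⟩ := h1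
      exact ⟨y, fun _ => ⟨hy, hyx⟩⟩
    · exact ⟨0, fun h => absurd h hx⟩
  choose h hh using hex
  have hm : MapsTo h (sphere 0 1) (sphere 0 1) := fun x hx => (hh x hx).1
  have hc : ContinuousOn h (sphere 0 1) := by
    refine ContinuousOn.of_comp_of_isCompact (isCompact_sphere 0 1) (hψ.mono hss) (hψi.mono hss)
      hm ?_
    exact (hf.comp (hφ.mono hss) (mapsTo_image φ _)).congr fun x hx => (hh x hx).2
  have hi : InjOn h (sphere 0 1) := by
    intro x hx y hy hxy
    have : f (φ x) = f (φ y) := by rw [← (hh x hx).2, ← (hh y hy).2, hxy]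
    exact hφi (hss hx) (hss hy) (hfi (mem_image_of_mem φ hx) (mem_image_of_mem φ hy) this)
  have hs : SurjOn h (sphere 0 1) (sphere 0 1) := by
    intro y hy
    have h1 : ψ y ∈ f '' (φ '' sphere 0 1) := himg ▸ mem_image_of_mem ψ hy
    obtain ⟨_, ⟨x, hx, rfl⟩, hxy⟩ := h1
    exact ⟨x, hx, hψi (hss (hm hx)) (hss hy) ((hh x hx).2.trans hxy)⟩
  have hinv : ∀ x ∈ closedBall (0 : E) 1, invFunOn φ (closedBall 0 1) (φ x) = x := fun x hx =>
    hφi.leftInvOn_invFunOn hx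
  set φ' := invFunOn φ (closedBall (0 : E) 1)
  have hφ' : ContinuousOn φ' (φ '' closedBall 0 1) :=
    hφ.invFunOn_of_isCompact (isCompact_closedBall 0 1) hφi
  have hball : ∀ x, x ∈ closedBall (0 : E) 1 → radialExtension h x ∈ closedBall (0 : E) 1 := by
    intro x hx
    rwa [mem_closedBall_zero_iff, norm_radialExtension hm, ← mem_closedBall_zero_iff]
  refine ⟨fun x => ψ (radialExtension h (φ' x)), ?_, ?_, ?_, ?_⟩
  · refine hψ.comp ((continuous_radialExtension hc hm).comp_continuousOn hφ') ?_
    rintro _ ⟨x, hx, rfl⟩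
    change radialExtension h (φ' (φ x)) ∈ _
    rw [hinv x hx]
    exact hball x hx
  · rintro _ ⟨x, hx, rfl⟩ _ ⟨y, hy, rfl⟩ hxy
    simp only [hinv x hx, hinv y hy] at hxy
    rw [injective_radialExtension hi hm (hψi (hball x hx) (hball y hy) hxy)]
  · apply Subset.antisymm
    · rintro _ ⟨_, ⟨x, hx, rfl⟩, rfl⟩
      simp only [hinv x hx]
      exact mem_image_of_mem ψ (hball x hx)
    · rintro _ ⟨y, hy, rfl⟩
      obtain ⟨x, rfl⟩ := surjective_radialExtension hs y
      have hx : x ∈ closedBall (0 : E) 1 := by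
        rwa [mem_closedBall_zero_iff, ← norm_radialExtension hm, ← mem_closedBall_zero_iff]
      exact ⟨φ x, mem_image_of_mem φ hx, by simp only [hinv x hx]⟩
  · rintro _ ⟨x, hx, rfl⟩
    simp only [hinv x (hss hx), radialExtension_of_mem_sphere h hx]
    exact (hh x hx).2

/-- A family of closed balls in `X`, indexed by a partially ordered set, that cover `X`, have
disjoint interiors, and such that the boundary of every ball is the union of the smaller ones. -/
structure IsBallComplex {A X : Type*} [PartialOrder A] [TopologicalSpace X] (d : A → ℕ)
    (φ : ∀ a, (Fin (d a) → ℝ) → X) : Prop where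
  continuousOn : ∀ a, ContinuousOn (φ a) (closedBall 0 1)
  injOn : ∀ a, InjOn (φ a) (closedBall 0 1)
  cover : ∀ x, ∃ a, x ∈ φ a '' closedBall 0 1
  boundary : ∀ a, φ a '' sphere 0 1 = ⋃ b < a, φ b '' closedBall 0 1
  disjoint : ∀ a b, a ≠ b → Disjoint (φ a '' ball 0 1) (φ b '' ball 0 1)

namespace IsBallComplex

variable {A X Y : Type*} [PartialOrder A] [TopologicalSpace X] [TopologicalSpace Y]
  {d : A → ℕ} {φ : ∀ a, (Fin (d a) → ℝ) → X} {ψ : ∀ a, (Fin (d a) → ℝ) → Y}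

theorem isClosed_image [T2Space X] (h : IsBallComplex d φ) (a : A) :
    IsClosed (φ a '' closedBall 0 1) :=
  ((isCompact_closedBall _ _).image_of_continuousOn (h.continuousOn a)).isClosed

variable [Finite A]

theorem exists_mem_image_ball (h : IsBallComplex d φ) (a : A) {x : X}
    (hx : x ∈ φ a '' closedBall 0 1) : ∃ b ≤ a, x ∈ φ b '' ball 0 1 := by
  induction a using WellFoundedLT.induction with
  | ind a ih =>
    rw [← ball_union_sphere, image_union] at hx
    rcases hx with hx | hx
    · exact ⟨a, le_rfl, hx⟩
    · rw [h.boundary] at hx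
      simp only [mem_iUnion] at hx
      obtain ⟨b, hb, hx⟩ := hx
      obtain ⟨c, hc, hx⟩ := ih b hb hx
      exact ⟨c, hc.trans hb.le, hx⟩

/-- A point of the ball `b` is interior to some ball `c ≤ b`. As `c ≠ a`, it cannot also be interior
to `a`. -/
theorem inter_subset (h : IsBallComplex d φ) {a b : A} (hab : ¬ a ≤ b) :
    φ a '' closedBall 0 1 ∩ φ b '' closedBall 0 1 ⊆ φ a '' sphere 0 1 := by
  rintro x ⟨hxa, hxb⟩
  obtain ⟨c, hc, hxc⟩ := h.exists_mem_image_ball b hxb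
  rw [← ball_union_sphere, image_union] at hxa
  rcases hxa with hxa | hxa
  · have hne : a ≠ c := by
      rintro rfl
      exact hab hc
    exact absurd hxc (disjoint_left.1 (h.disjoint a c hne) hxa)
  · exact hxa

/-- Induction on the number of cells: remove a maximal cell `a`, map the rest, which contains the
boundary of `a`, and extend over `a` by the Alexander trick. -/
theorem exists_map_of_isLowerSet [T2Space X] [T2Space Y] (h : IsBallComplex d φ)
    (h' : IsBallComplex d ψ) (D : Finset A) (hD : IsLowerSet (D : Set A)) : ∃ f : X → Y,
      ContinuousOn f (⋃ a ∈ D, φ a '' closedBall 0 1) ∧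
      InjOn f (⋃ a ∈ D, φ a '' closedBall 0 1) ∧
      ∀ a ∈ D, f '' (φ a '' closedBall 0 1) = ψ a '' closedBall 0 1 := by
  classical
  induction hn : D.card generalizing D with
  | zero =>
    rw [Finset.card_eq_zero] at hn
    subst hn
    by_cases hX : Nonempty Y
    · obtain ⟨y⟩ := hX
      exact ⟨fun _ => y, by simp, by simp, by simp⟩
    -- A point of `X` would lie in some cell `a`, and then `ψ a 0` would be a point of `Y`.
    · have hXe : IsEmpty X := by
        refine ⟨fun x => hX ?_⟩
        obtain ⟨a, -⟩ := h.cover x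
        exact ⟨ψ a 0⟩
      exact ⟨fun x => (hXe.false x).elim, by simp, by simp, by simp⟩
  | succ n ih =>
    have hne : D.Nonempty := by
      rw [← Finset.card_pos]
      omega
    obtain ⟨a, ha⟩ := D.exists_maximal hne
    have hnle : ∀ b ∈ D.erase a, ¬ a ≤ b := fun b hb hab =>
      (Finset.mem_erase.1 hb).1 (le_antisymm (ha.2 (Finset.mem_of_mem_erase hb) hab) hab)
    have hlt : ∀ b < a, b ∈ D.erase a := fun b hb =>
      Finset.mem_erase.2 ⟨hb.ne, hD hb.le ha.1⟩
    obtain ⟨f, hfc, hfi, hfim⟩ := ih (D.erase a)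
      (by
        intro b c hcb hb
        have hb' := Finset.mem_coe.1 hb
        refine Finset.mem_coe.2 (Finset.mem_erase.2 ⟨?_, hD hcb (Finset.mem_of_mem_erase hb')⟩)
        rintro rfl
        exact hnle b hb' hcb)
      (by rw [Finset.card_erase_of_mem ha.1]; omega)
    set U := ⋃ b ∈ D.erase a, φ b '' closedBall 0 1 with hU
    have hsub : φ a '' sphere 0 1 ⊆ U := by
      rw [h.boundary]
      exact iUnion₂_subset fun b hb => subset_biUnion_of_mem (u := fun b => φ b '' closedBall 0 1)
        (hlt b hb)
    have hinter : φ a '' closedBall 0 1 ∩ U ⊆ φ a '' sphere 0 1 := by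
      rintro x ⟨hxa, hx⟩
      simp only [hU, mem_iUnion] at hx
      obtain ⟨b, hb, hxb⟩ := hx
      exact h.inter_subset (hnle b hb) ⟨hxa, hxb⟩
    have himg : f '' (φ a '' sphere 0 1) = ψ a '' sphere 0 1 := by
      rw [h.boundary, h'.boundary, image_iUnion₂]
      exact iUnion₂_congr fun b hb => hfim b (hlt b hb)
    obtain ⟨g, hgc, hgi, hgim, hgf⟩ := exists_extension_of_ball (h.continuousOn a) (h.injOn a)
      (h'.continuousOn a) (h'.injOn a) (hfc.mono hsub) (hfi.mono hsub) himg
    set F : X → Y := fun x => if x ∈ U then f x else g x with hF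
    have hFU : EqOn F f U := fun x hx => if_pos hx
    have hFa : EqOn F g (φ a '' closedBall 0 1) := by
      intro x hx
      by_cases hxU : x ∈ U
      · rw [hFU hxU, hgf (hinter ⟨hx, hxU⟩)]
      · exact if_neg hxU
    have hUD : ⋃ b ∈ D, φ b '' closedBall 0 1 = φ a '' closedBall 0 1 ∪ U := by
      conv_lhs => rw [← Finset.insert_erase ha.1]
      rw [Finset.set_biUnion_insert]
    have hUc : IsClosed U := (D.erase a).finite_toSet.isClosed_biUnion fun b _ => h.isClosed_image b
    -- In `Y`, the cell `a` meets the other cells only in its boundary. So the common image comes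
    -- from the boundary of `a` in `X`, and injectivity of `g` puts `x` there.
    have hcross : ∀ x ∈ φ a '' closedBall 0 1, ∀ y ∈ U, F x = F y → x ∈ U := by
      intro x hx y hy hxy
      rw [hFa hx, hFU hy] at hxy
      simp only [hU, mem_iUnion] at hy
      obtain ⟨b, hb, hyb⟩ := hy
      have h1 : f y ∈ ψ a '' sphere 0 1 := h'.inter_subset (hnle b hb)
        ⟨by rw [← hxy, ← hgim]; exact mem_image_of_mem g hx,
          by rw [← hfim b hb]; exact mem_image_of_mem f hyb⟩
      rw [← himg] at h1
      obtain ⟨z, hz, hzy⟩ := h1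
      rw [← hgf hz, ← hxy] at hzy
      have := hgi (image_mono sphere_subset_closedBall hz) hx hzy
      exact hsub (this ▸ hz)
    refine ⟨F, ?_, ?_, ?_⟩
    · rw [hUD]
      exact (hgc.congr hFa).union_of_isClosed (hfc.congr hFU) (h.isClosed_image a) hUc
    · rw [hUD]
      have hi1 := hgi.congr hFa.symm
      have hi2 := hfi.congr hFU.symm
      rintro x (hx | hx) y (hy | hy) hxy
      · exact hi1 hx hy hxy
      · exact hi2 (hcross x hx y hy hxy) hy hxy
      · exact hi2 hx (hcross y hy x hx hxy.symm) hxy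
      · exact hi2 hx hy hxy
    · intro b hb
      by_cases hba : b = a
      · subst hba
        rw [hFa.image_eq, hgim]
      · have hb' := Finset.mem_erase.2 ⟨hba, hb⟩
        rw [(hFU.mono (subset_biUnion_of_mem (u := fun b => φ b '' closedBall 0 1)
          hb')).image_eq, hfim b hb']

theorem compactSpace (h : IsBallComplex d φ) : CompactSpace X := by
  refine ⟨?_⟩
  have : (univ : Set X) = ⋃ a, φ a '' closedBall 0 1 := by
    symm
    rw [eq_univ_iff_forall]
    exact fun x => mem_iUnion.2 (h.cover x)
  rw [this]
  exact isCompact_iUnion fun a => (isCompact_closedBall _ _).image_of_continuousOn (h.continuousOn a)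

/-- Ball complexes with the same combinatorics are homeomorphic. -/
theorem exists_homeomorph [T2Space X] [T2Space Y] (h : IsBallComplex d φ)
    (h' : IsBallComplex d ψ) :
    ∃ f : X ≃ₜ Y, ∀ a, f '' (φ a '' closedBall 0 1) = ψ a '' closedBall 0 1 := by
  have := Fintype.ofFinite A
  obtain ⟨f, hc, hi, him⟩ := h.exists_map_of_isLowerSet h' Finset.univ (by simp [isLowerSet_univ])
  have hU : ⋃ a ∈ Finset.univ, φ a '' closedBall 0 1 = (univ : Set X) := by
    rw [eq_univ_iff_forall]
    intro x
    obtain ⟨a, ha⟩ := h.cover x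
    simp only [mem_iUnion]
    exact ⟨a, Finset.mem_univ a, ha⟩
  rw [hU] at hc hi
  rw [continuousOn_univ] at hc
  rw [injOn_univ] at hi
  have hs : Surjective f := by
    intro y
    obtain ⟨a, ha⟩ := h'.cover y
    rw [← him a (Finset.mem_univ a)] at ha
    obtain ⟨x, -, rfl⟩ := ha
    exact ⟨x, rfl⟩
  have := h.compactSpace
  let e := Equiv.ofBijective f ⟨hi, hs⟩
  have he : Continuous e := hc
  exact ⟨he.homeoOfEquivCompactToT2, fun a => him a (Finset.mem_univ a)⟩

end IsBallComplex

end BallComplexes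

/-! ### Complexes `CP_{n+1}` as ball complexes -/

section CPComplexes

open Metric Set Topology

/-- The labels of the cells of `CP_{n+1}` of all dimensions. -/
structure CPCell (n : ℕ) : Type where
  /-- The dimension of the cell. -/
  dim : ℕ
  /-- The label of the cell. -/
  label : CPLabel n dim

namespace CPCell

variable {n : ℕ}

theorem ext_partition {a b : CPCell n} (h : a.label.1 = b.label.1) : a = b := by
  obtain ⟨k, p, hp3, hp⟩ := a
  obtain ⟨l, q, hq3, hq⟩ := b
  obtain rfl : p = q := h
  obtain rfl : k = l := by omega
  rfl

instance : PartialOrder (CPCell n) := PartialOrder.lift (fun a => a.label.1) fun _ _ => ext_partition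

theorem le_iff {a b : CPCell n} : a ≤ b ↔ a.label.1 ≤ b.label.1 := Iff.rfl

instance : Finite (CPCell n) :=
  Finite.of_injective (fun a : CPCell n => a.label.1) fun _ _ => ext_partition

theorem dim_lt_of_lt {a b : CPCell n} (h : a < b) : a.dim < b.dim := by
  have h1 : a.label.1 < b.label.1 := lt_of_le_of_ne h.le fun e => h.ne (ext_partition e)
  have := CyclicPartition.numParts_lt_of_lt h1
  have ha := a.label.2.2
  have hb := b.label.2.2
  omega

/-- Refining never lowers the number of parts, so the bound of three parts is inherited: below a
label lie all of its refinements. -/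
theorem exists_of_le {p : CyclicPartition (Fin (n + 1))} {b : CPCell n} (h : p ≤ b.label.1) :
    ∃ a : CPCell n, a.label.1 = p := by
  have h1 : p.numParts ≤ n + 1 := by simpa using p.numParts_le_card
  have h2 : b.label.1.numParts ≤ p.numParts := by
    rcases h.eq_or_lt with e | e
    · rw [e]
    · exact (CyclicPartition.numParts_lt_of_lt e).le
  have h3 := b.label.2.1
  exact ⟨⟨n + 1 - p.numParts, p, by omega, by omega⟩, rfl⟩

end CPCell

namespace CPComplex

variable {n : ℕ} {X : Type*} [TopologicalSpace X] [CWComplex (univ : Set X)]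

theorem closedCell_subset_iff (K : CPComplex n X) (a b : CPCell n) :
    K.closedCell a.label ⊆ K.closedCell b.label ↔ a ≤ b := by
  rw [CPComplex.closedCell, CPComplex.closedCell, K.incidence, Equiv.apply_symm_apply,
    Equiv.apply_symm_apply]
  rfl

theorem isBallComplex (K : CPComplex n X) :
    IsBallComplex (fun a : CPCell n => a.dim)
      (fun a => RelCWComplex.map (C := (univ : Set X)) a.dim ((K.label a.dim).symm a.label)) where
  continuousOn a := RelCWComplex.continuousOn _ _
  injOn a := K.regular.injOn _ _
  cover x := by
    have hx : x ∈ (univ : Set X) := mem_univ x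
    rw [← CWComplex.union (C := (univ : Set X))] at hx
    simp only [mem_iUnion] at hx
    obtain ⟨k, i, hx⟩ := hx
    refine ⟨⟨k, K.label k i⟩, ?_⟩
    change x ∈ RelCWComplex.closedCell k ((K.label k).symm (K.label k i))
    rwa [Equiv.symm_apply_apply]
  boundary a := by
    have := K.regular.t2
    apply Subset.antisymm
    · obtain ⟨J, hJ, hJ'⟩ := K.regular.frontier_eq a.dim ((K.label a.dim).symm a.label)
      intro x hx
      have hx' : x ∈ RelCWComplex.cellFrontier a.dim ((K.label a.dim).symm a.label) := hx
      rw [hJ'] at hx'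
      simp only [mem_iUnion] at hx'
      obtain ⟨p, hp, hx'⟩ := hx'
      let b : CPCell n := ⟨p.1, K.label p.1 p.2⟩
      have hb : K.closedCell b.label = RelCWComplex.closedCell p.1 p.2 := by
        simp [b, CPComplex.closedCell]
      have hba : b ≤ a := by
        rw [← K.closedCell_subset_iff, hb]
        refine Subset.trans ?_ (RelCWComplex.cellFrontier_subset_closedCell _ _)
        rw [hJ']
        exact subset_biUnion_of_mem (u := fun p : Σ m : ℕ, RelCWComplex.cell (univ : Set X) m =>
          RelCWComplex.closedCell p.1 p.2) hp
      have hne : b ≠ a := by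
        rintro e
        have h1 := hJ p hp
        have h2 : b.dim = a.dim := by rw [e]
        exact h1.ne h2
      refine mem_iUnion₂.2 ⟨b, lt_of_le_of_ne hba hne, ?_⟩
      change x ∈ K.closedCell b.label
      rwa [hb]
    · refine iUnion₂_subset fun b hb => ?_
      -- The open cell of `b` lies in the closed cell of `a` and, having smaller dimension, misses
      -- the open cell of `a`. The frontier being closed, it then contains the closed cell of `b`.
      have h1 : RelCWComplex.openCell b.dim ((K.label b.dim).symm b.label) ⊆
          RelCWComplex.cellFrontier a.dim ((K.label a.dim).symm a.label) := by
        intro x hx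
        have hx' := (K.closedCell_subset_iff b a).2 hb.le
          (RelCWComplex.openCell_subset_closedCell _ _ hx)
        rw [CPComplex.closedCell, ← RelCWComplex.cellFrontier_union_openCell_eq_closedCell] at hx'
        refine hx'.resolve_right fun hxa => ?_
        have hdim := CPCell.dim_lt_of_lt hb
        refine disjoint_left.1 (RelCWComplex.disjoint_openCell_of_ne (D := ∅) ?_) hx hxa
        intro e
        exact hdim.ne (Sigma.mk.inj e).1
      have h2 := closure_minimal h1 RelCWComplex.isClosed_cellFrontier
      rwa [RelCWComplex.closure_openCell_eq_closedCell] at h2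
  disjoint a b hab := by
    refine RelCWComplex.disjoint_openCell_of_ne (D := ∅) ?_
    intro e
    apply hab
    obtain ⟨k, p⟩ := a
    obtain ⟨l, q⟩ := b
    obtain rfl : k = l := (Sigma.mk.inj e).1
    obtain rfl : p = q := (K.label k).symm.injective (eq_of_heq (Sigma.mk.inj e).2)
    rfl

/-- The cells contained in a closed cell are ordered as the refinements of its label. -/
noncomputable def cellsInIso (K : CPComplex n X) {k : ℕ} (p : CPLabel n k) :
    {q : CyclicPartition (Fin (n + 1)) // q ≤ p.1} ≃o K.CellsIn p :=
  have hex : ∀ q : {q : CyclicPartition (Fin (n + 1)) // q ≤ p.1}, ∃ a : CPCell n, a.label.1 = q.1 :=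
    fun q => CPCell.exists_of_le (b := ⟨k, p⟩) q.2
  RelIso.ofSurjective
    (OrderEmbedding.ofMapLEIff
      (fun q => ⟨K.closedCell (hex q).choose.label, ⟨_, _, rfl⟩,
        (K.closedCell_subset_iff (hex q).choose ⟨k, p⟩).2 (by
          rw [CPCell.le_iff, (hex q).choose_spec]
          exact q.2)⟩)
      (by
        intro q q'
        refine (K.closedCell_subset_iff _ _).trans ?_
        rw [CPCell.le_iff, (hex q).choose_spec, (hex q').choose_spec]
        rfl))
    (by
      rintro ⟨S, ⟨l, q, rfl⟩, hS⟩
      have hq := (K.closedCell_subset_iff ⟨l, q⟩ ⟨k, p⟩).1 hS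
      refine ⟨⟨q.1, hq⟩, Subtype.ext ?_⟩
      change K.closedCell (hex ⟨q.1, hq⟩).choose.label = _
      have : (hex ⟨q.1, hq⟩).choose = (⟨l, q⟩ : CPCell n) :=
        CPCell.ext_partition (hex ⟨q.1, hq⟩).choose_spec
      rw [this])

theorem exists_homeomorph {Y : Type*} [TopologicalSpace Y] [CWComplex (univ : Set Y)]
    (K : CPComplex n X) (L : CPComplex n Y) :
    ∃ h : X ≃ₜ Y, ∀ (k : ℕ) (p : CPLabel n k), h '' K.closedCell p = L.closedCell p := by
  have := K.regular.t2
  have := L.regular.t2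
  obtain ⟨h, hh⟩ := K.isBallComplex.exists_homeomorph L.isBallComplex
  exact ⟨h, fun k p => hh ⟨k, p⟩⟩

end CPComplex

end CPComplexes

/-! ### Faces of products of permutohedra -/

section Permutohedra

open Set

/-- The face of the permutohedron on which the linear functional with coefficients `c` is
maximal. -/
def permutohedronFace {m : ℕ} (c : Fin m → ℝ) : Set (Fin m → ℝ) :=
  {x ∈ permutohedron m | ∀ y ∈ permutohedron m, ∑ i, c i * y i ≤ ∑ i, c i * x i}

/-- The vertex of the permutohedron given by a permutation. -/
def permutohedronVertex {m : ℕ} (σ : Equiv.Perm (Fin m)) (i : Fin m) : ℝ := ((σ i : ℕ) : ℝ) + 1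

variable {m : ℕ}

theorem permutohedronVertex_mem (σ : Equiv.Perm (Fin m)) :
    permutohedronVertex σ ∈ permutohedron m :=
  subset_convexHull _ _ ⟨σ, rfl⟩

theorem permutohedron_functional_le {c : Fin m → ℝ} {M : ℝ}
    (h : ∀ σ : Equiv.Perm (Fin m), ∑ i, c i * permutohedronVertex σ i ≤ M) :
    ∀ y ∈ permutohedron m, ∑ i, c i * y i ≤ M := by
  have hconv : Convex ℝ {y : Fin m → ℝ | ∑ i, c i * y i ≤ M} := by
    refine convex_halfSpace_le ⟨fun x y => ?_, fun t x => ?_⟩ M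
    · simp [mul_add, Finset.sum_add_distrib]
    · simp only [Pi.smul_apply, smul_eq_mul, Finset.mul_sum]
      exact Finset.sum_congr rfl fun i _ => by ring
  exact fun y hy => convexHull_min (by rintro _ ⟨σ, rfl⟩; exact h σ) hconv hy

/-- The rearrangement inequality; its equality case gives `permutohedronVertex_mem_face_iff`. -/
theorem sum_mul_permutohedronVertex_le {c : Fin m → ℝ} {σ : Equiv.Perm (Fin m)}
    (h : ∀ i j, c i < c j → σ i < σ j) (τ : Equiv.Perm (Fin m)) :
    ∑ i, c i * permutohedronVertex τ i ≤ ∑ i, c i * permutohedronVertex σ i := by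
  have hm : Monovary (permutohedronVertex σ) c := by
    intro i j hij
    simpa [permutohedronVertex] using (h i j hij).le
  have h1 := hm.sum_comp_perm_mul_le_sum_mul (σ := τ.trans σ.symm)
  simp only [permutohedronVertex, Equiv.trans_apply, Equiv.apply_symm_apply] at h1 ⊢
  simpa only [mul_comm] using h1

theorem exists_perm_of_le (c : Fin m → ℝ) {i j : Fin m} (hij : i ≠ j) (hc : c i ≤ c j) :
    ∃ σ : Equiv.Perm (Fin m), (∀ k l, c k < c l → σ k < σ l) ∧ σ i < σ j := by
  -- Sort by `c`, with `i` placed first among the indices tied with it.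
  let f : Fin m → ℝ ×ₗ ℕ := fun k => toLex (c k, if k = i then 0 else 1)
  have key : ∀ k l, f k < f l → (Tuple.sort f).symm k < (Tuple.sort f).symm l := by
    intro k l hkl
    by_contra hle
    have := Tuple.monotone_sort f (not_lt.1 hle)
    simp only [Function.comp, Equiv.apply_symm_apply] at this
    exact absurd hkl (not_lt.2 this)
  refine ⟨(Tuple.sort f).symm, fun k l hkl => key k l ?_, key i j ?_⟩
  · exact Prod.Lex.toLex_lt_toLex.2 (Or.inl hkl)
  · refine Prod.Lex.toLex_lt_toLex.2 ?_
    rcases hc.lt_or_eq with h | h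
    · exact Or.inl h
    · exact Or.inr ⟨h, by simp [hij.symm]⟩

theorem exists_sorting_perm (c : Fin m → ℝ) :
    ∃ σ : Equiv.Perm (Fin m), ∀ k l, c k < c l → σ k < σ l := by
  refine ⟨(Tuple.sort c).symm, fun k l hkl => ?_⟩
  by_contra hle
  have := Tuple.monotone_sort c (not_lt.1 hle)
  simp only [Function.comp, Equiv.apply_symm_apply] at this
  exact absurd hkl (not_lt.2 this)

theorem permutohedronVertex_mem_face_iff {c : Fin m → ℝ} {σ : Equiv.Perm (Fin m)} :
    permutohedronVertex σ ∈ permutohedronFace c ↔ ∀ i j, c i < c j → σ i < σ j := by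
  constructor
  · intro h i j hij
    obtain ⟨τ, hτ⟩ := exists_sorting_perm c
    have hm : Monovary (permutohedronVertex τ) c := by
      intro i j hij
      simpa [permutohedronVertex] using (hτ i j hij).le
    have h1 := sum_mul_permutohedronVertex_le hτ σ
    have h2 := h.2 _ (permutohedronVertex_mem τ)
    have h3 := (hm.sum_comp_perm_mul_eq_sum_mul_iff (σ := σ.trans τ.symm)).1 (by
      have := le_antisymm h1 h2
      simp only [permutohedronVertex, Equiv.trans_apply, Equiv.apply_symm_apply] at this ⊢
      simpa only [mul_comm] using this)
    have h4 := h3 hij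
    simp only [permutohedronVertex, Function.comp, Equiv.trans_apply, Equiv.apply_symm_apply,
      add_le_add_iff_right, Nat.cast_le, Fin.val_fin_le] at h4
    refine lt_of_le_of_ne h4 fun e => ?_
    rw [σ.injective e] at hij
    exact lt_irrefl _ hij
  · intro h
    exact ⟨permutohedronVertex_mem σ,
      permutohedron_functional_le (sum_mul_permutohedronVertex_le h)⟩

theorem permutohedronFace_nonempty (c : Fin m → ℝ) : (permutohedronFace c).Nonempty := by
  obtain ⟨σ, hσ⟩ := exists_sorting_perm c
  exact ⟨_, permutohedronVertex_mem_face_iff.2 hσ⟩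

/-- The faces of the permutohedron are ordered as the preorders induced by their functionals. -/
theorem permutohedronFace_subset_iff {c d : Fin m → ℝ} :
    permutohedronFace c ⊆ permutohedronFace d ↔ ∀ i j, c i ≤ c j → d i ≤ d j := by
  constructor
  · intro h i j hij
    by_cases e : i = j
    · rw [e]
    -- A vertex of the face of `c` that ranks `i` before `j`; lying also in the face of `d`, it
    -- excludes `d j < d i`.
    · obtain ⟨σ, hσ, hσij⟩ := exists_perm_of_le c e hij
      have h1 := permutohedronVertex_mem_face_iff.1 (h (permutohedronVertex_mem_face_iff.2 hσ))
      by_contra hd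
      exact absurd (h1 j i (not_le.1 hd)) (not_lt.2 hσij.le)
  · rintro h x ⟨hx, hmax⟩
    refine ⟨hx, ?_⟩
    obtain ⟨τ, hτ⟩ := exists_sorting_perm d
    obtain ⟨ι, _, w, z, hw, hw1, hz, rfl⟩ := mem_convexHull_iff_exists_fintype.1 hx
    have hsum : ∀ a : Fin m → ℝ, ∑ i, a i * (∑ k, w k • z k) i = ∑ k, w k * ∑ i, a i * z k i := by
      intro a
      simp only [Finset.sum_apply, Pi.smul_apply, smul_eq_mul, Finset.mul_sum]
      rw [Finset.sum_comm]
      exact Finset.sum_congr rfl fun k _ => Finset.sum_congr rfl fun i _ => by ring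
    have hzP : ∀ k, z k ∈ permutohedron m := fun k => subset_convexHull _ _ (hz k)
    set M := ∑ i, c i * (∑ k, w k • z k) i with hM
    -- The maximum `M` is an average of values at most `M`, so only vertices attaining it carry
    -- weight. Such vertices sort `c`, hence also `d`.
    have hzero : ∀ k, w k * (M - ∑ i, c i * z k i) = 0 := by
      have h1 : ∑ k, w k * (M - ∑ i, c i * z k i) = 0 := by
        simp only [mul_sub, Finset.sum_sub_distrib]
        rw [← hsum, ← Finset.sum_mul, hw1, one_mul, sub_self]
      have h2 := (Finset.sum_eq_zero_iff_of_nonneg fun k _ =>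
        mul_nonneg (hw k) (sub_nonneg.2 (hmax _ (hzP k)))).1 h1
      exact fun k => h2 k (Finset.mem_univ k)
    have hterm : ∀ k, w k * (∑ i, d i * z k i) =
        w k * ∑ i, d i * permutohedronVertex τ i := by
      intro k
      rcases mul_eq_zero.1 (hzero k) with h0 | h0
      · rw [h0, zero_mul, zero_mul]
      · congr 1
        obtain ⟨σ, hσ⟩ := hz k
        have hσ' : permutohedronVertex σ = z k := hσ
        have hface : permutohedronVertex σ ∈ permutohedronFace c := by
          refine ⟨permutohedronVertex_mem σ, ?_⟩
          rw [hσ', ← sub_eq_zero.1 h0]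
          exact hmax
        rw [permutohedronVertex_mem_face_iff] at hface
        have hσd : ∀ i j, d i < d j → σ i < σ j := fun i j hij =>
          hface i j (not_le.1 fun hle => absurd hij (not_lt.2 (h j i hle)))
        rw [← hσ']
        exact le_antisymm (sum_mul_permutohedronVertex_le hτ σ)
          (sum_mul_permutohedronVertex_le hσd τ)
    rw [hsum, Finset.sum_congr rfl fun k _ => hterm k, ← Finset.sum_mul, hw1, one_mul]
    exact permutohedron_functional_le (sum_mul_permutohedronVertex_le hτ)

variable {N : ℕ} {μ : Fin N → ℕ}

/-- The maximum of a functional on a product is attained exactly at the products of maximum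
points. -/
theorem permutohedronProd_maximizers (c : ∀ j, Fin (μ j) → ℝ) :
    {x ∈ permutohedronProd μ | ∀ y ∈ permutohedronProd μ,
      ∑ j, ∑ i, c j i * y j i ≤ ∑ j, ∑ i, c j i * x j i} =
    univ.pi fun j => permutohedronFace (c j) := by
  ext x
  constructor
  · rintro ⟨hx, hmax⟩ j -
    refine ⟨hx j (mem_univ j), fun y hy => ?_⟩
    have h1 := hmax (Function.update x j y) (by
      intro l _
      by_cases e : l = j
      · subst e
        simpa using hy
      · simpa [e] using hx l (mem_univ l))
    rw [← Finset.add_sum_erase _ _ (Finset.mem_univ j),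
      ← Finset.add_sum_erase (a := j) (f := fun j => ∑ i, c j i * x j i) _ (Finset.mem_univ j),
      Finset.sum_congr (g := fun j => ∑ i, c j i * x j i) rfl fun l hl => by
        rw [Function.update_of_ne (Finset.ne_of_mem_erase hl)]] at h1
    simp only [Function.update_self] at h1
    exact (add_le_add_iff_right _).1 h1
  · intro hx
    exact ⟨fun j hj => (hx j hj).1, fun y hy => Finset.sum_le_sum fun j _ =>
      (hx j (mem_univ j)).2 _ (hy j (mem_univ j))⟩

theorem isExposed_pi_permutohedronFace (c : ∀ j, Fin (μ j) → ℝ) :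
    IsExposed ℝ (permutohedronProd μ) (univ.pi fun j => permutohedronFace (c j)) := by
  intro _
  let l : (∀ j, Fin (μ j) → ℝ) →ₗ[ℝ] ℝ :=
    ∑ j, ∑ i, c j i • ((LinearMap.proj (R := ℝ) i).comp
      (LinearMap.proj (R := ℝ) (φ := fun j => Fin (μ j) → ℝ) j))
  have hl : ∀ x, l x = ∑ j, ∑ i, c j i * x j i := by
    intro x
    simp [l]
  refine ⟨⟨l, l.continuous_of_finiteDimensional⟩, ?_⟩
  rw [← permutohedronProd_maximizers]
  simp only [ContinuousLinearMap.coe_mk', hl]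

theorem exists_eq_pi_permutohedronFace {F : Set (∀ j, Fin (μ j) → ℝ)} (hne : F.Nonempty)
    (hF : IsExposed ℝ (permutohedronProd μ) F) :
    ∃ c : ∀ j, Fin (μ j) → ℝ, F = univ.pi fun j => permutohedronFace (c j) := by
  obtain ⟨l, rfl⟩ := hF hne
  refine ⟨fun j i => l (Pi.single j (Pi.single i 1)), ?_⟩
  rw [← permutohedronProd_maximizers]
  have hl : ∀ x, l x = ∑ j, ∑ i, l (Pi.single j (Pi.single i 1)) * x j i := by
    intro x
    have hx : x = ∑ j, ∑ i, x j i • Pi.single j (Pi.single i (1 : ℝ)) := by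
      funext j i
      simp only [Finset.sum_apply, Pi.smul_apply, smul_eq_mul]
      rw [Finset.sum_eq_single j]
      · rw [Finset.sum_eq_single i]
        · simp
        · intro k _ hk
          simp [hk.symm]
        · simp
      · intro k _ hk
        refine Finset.sum_eq_zero fun l _ => ?_
        rw [Pi.single_eq_of_ne hk.symm]
        simp
      · simp
    conv_lhs => rw [hx]
    simp [map_sum, mul_comm]
  simp only [← hl]

variable {α : Type*} [Fintype α]

/-- The total preorders refining a linear order of the parts `I` correspond to the faces of the
product of the permutohedra of the parts. -/
noncomputable def facesIso {I : List (Finset α)} {s : TotalPreorder α} (hs : OrdersBy I s.1) :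
    {r : TotalPreorder α // r ≤ s} ≃o
      Faces (permutohedronProd fun j : Fin I.length => (I.get j).card) :=
  RelIso.ofSurjective
    (OrderEmbedding.ofMapLEIff
      (fun r => ⟨univ.pi fun j => permutohedronFace fun k =>
          (r.1.rank ((I.get j).equivFin.symm k) : ℝ),
        univ_pi_nonempty_iff.2 fun j => permutohedronFace_nonempty _,
        isExposed_pi_permutohedronFace _⟩)
      (by
        intro r r'
        have hne : (univ.pi fun j : Fin I.length => permutohedronFace fun k =>
            (r.1.rank ((I.get j).equivFin.symm k) : ℝ)).Nonempty :=
          univ_pi_nonempty_iff.2 fun j => permutohedronFace_nonempty _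
        refine (pi_subset_pi_iff (s := univ)).trans ?_
        rw [or_iff_left (by exact hne.ne_empty)]
        simp only [mem_univ, true_implies, permutohedronFace_subset_iff, Nat.cast_le,
          TotalPreorder.rank_le_rank_iff]
        obtain ⟨b, hb, hbs⟩ := hs.exists_index
        constructor
        · intro h i i' hii'
          -- Elements of different parts are compared by `s` alone; inside one part the comparison
          -- of faces applies.
          rcases ((hbs i i').1 (r.2 i i' hii')).lt_or_eq with e | e
          · exact (r'.1.2.1 i i').resolve_right fun h' =>
              absurd ((hbs i' i).1 (r'.2 i' i h')) (not_le.2 e)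
          · have hi := (hb i (b i')).2 e
            have hi' := (hb i' (b i')).2 rfl
            simpa using h (b i') ((I.get (b i')).equivFin ⟨i, hi⟩)
              ((I.get (b i')).equivFin ⟨i', hi'⟩) (by simpa using hii')
        · exact fun h j k k' hkk' => h _ _ hkk'))
    (by
      rintro ⟨F, hne, hF⟩
      obtain ⟨c, rfl⟩ := exists_eq_pi_permutohedronFace hne hF
      obtain ⟨b, hb, hbs⟩ := hs.exists_index
      let y : α → ℝ := fun i => c (b i) ((I.get (b i)).equivFin ⟨i, (hb i (b i)).2 rfl⟩)
      have hy : ∀ j k, y ((I.get j).equivFin.symm k) = c j k := by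
        intro j k
        have hj : b ((I.get j).equivFin.symm k) = j := (hb _ _).1 (Subtype.prop _)
        have key : ∀ (l : Fin I.length) (i : α) (hi : i ∈ I.get l), l = j →
            i = (I.get j).equivFin.symm k → c l ((I.get l).equivFin ⟨i, hi⟩) = c j k := by
          rintro l i hi rfl rfl
          simp
        exact key _ _ _ hj rfl
      -- The preorder of a given face: compare the parts first, then the coefficients inside a part.
      let z : α → Fin I.length ×ₗ ℝ := fun i => toLex (b i, y i)
      let r : TotalPreorder α := ⟨fun i i' => z i ≤ z i', fun i j => le_total _ _,
        fun i j k => le_trans⟩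
      have hrs : r ≤ s := by
        intro i i' h
        rw [hbs]
        rcases Prod.Lex.toLex_le_toLex.1 h with e | e
        · exact le_of_lt e
        · exact e.1.le
      refine ⟨⟨r, hrs⟩, Subtype.ext ?_⟩
      have key : ∀ j k k', r.rank ((I.get j).equivFin.symm k) ≤
          r.rank ((I.get j).equivFin.symm k') ↔ c j k ≤ c j k' := by
        intro j k k'
        rw [TotalPreorder.rank_le_rank_iff]
        have hj : ∀ k, b ((I.get j).equivFin.symm k) = j := fun k => (hb _ _).1 (Subtype.prop _)
        refine Prod.Lex.toLex_le_toLex.trans ?_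
        simp only [hj, hy, lt_self_iff_false, true_and, false_or]
      refine pi_congr rfl fun j _ => Subset.antisymm ?_ ?_ <;> rw [permutohedronFace_subset_iff]
      · intro k k' h
        exact (key j k k').1 (by exact_mod_cast h)
      · intro k k' h
        exact_mod_cast (key j k k').2 h)

end Permutohedra

/-! ### Cells of the order complex in terms of weights on sets -/

section OrderComplexCells

open Metric Set
open scoped Classical

/-- The points of the order complex of `A`, in barycentric coordinates, that lie on the simplices
spanned by chains below `a`. -/
def orderCone {A : Type*} [PartialOrder A] [Fintype A] (a : A) : Set (A → ℝ) :=
  {t | (∀ q, 0 ≤ t q) ∧ ∑ q, t q = 1 ∧ IsChain (· ≤ ·) {q | t q ≠ 0} ∧ ∀ q, t q ≠ 0 → q ≤ a}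

/-- `G` identifies the elements below `a` with the chains of non-empty proper subsets of `α` that
refine the chain of upper sets of a weak order `π`. -/
structure IsFlagLabeling {A α : Type*} [PartialOrder A] [Fintype α] {m : ℕ} (a : A)
    (G : A → Finset (Finset α)) (π : α → Fin m) : Prop where
  le_iff : ∀ q ≤ a, ∀ q' ≤ a, q ≤ q' ↔ G q' ⊆ G q
  nonempty : ∀ q ≤ a, ∀ S ∈ G q, S.Nonempty
  ne_univ : ∀ q ≤ a, ∀ S ∈ G q, S ≠ Finset.univ
  chain : ∀ q ≤ a, IsChain (· ≤ ·) (G q : Set (Finset α))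
  exists_eq : ∀ C : Finset (Finset α), G a ⊆ C → (∀ S ∈ C, S.Nonempty) →
    (∀ S ∈ C, S ≠ Finset.univ) → IsChain (· ≤ ·) (C : Set (Finset α)) → ∃ q ≤ a, G q = C
  mem_iff : ∀ S, S ∈ G a ↔ S.Nonempty ∧ S ≠ Finset.univ ∧ ∀ i ∈ S, ∀ j, π i ≤ π j → j ∈ S

namespace IsFlagLabeling

variable {A α : Type*} {m : ℕ} {a : A} {G : A → Finset (Finset α)} {π : α → Fin m}

/-- The weights of the sets outside `G a` determined by a point of the order complex. -/
noncomputable def offWeight [Fintype A] (a : A) (G : A → Finset (Finset α)) :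
    (A → ℝ) →ₗ[ℝ] (Finset α → ℝ) where
  toFun t S := if S ∈ G a then 0 else ∑ q, if S ∈ G q then t q else 0
  map_add' t t' := by
    funext S
    by_cases h : S ∈ G a
    · simp [h]
    · simp only [h, if_false, Pi.add_apply, ← Finset.sum_add_distrib]
      refine Finset.sum_congr rfl fun q _ => ?_
      split_ifs <;> simp
  map_smul' c t := by
    funext S
    by_cases h : S ∈ G a
    · simp [h]
    · simp only [h, if_false, Pi.smul_apply, smul_eq_mul, Finset.mul_sum, RingHom.id_apply]
      refine Finset.sum_congr rfl fun q _ => ?_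
      split_ifs <;> simp

theorem offWeight_of_mem [Fintype A] {S : Finset α} (h : S ∈ G a) (t : A → ℝ) : offWeight a G t S = 0 :=
  if_pos h

theorem offWeight_of_notMem [Fintype A] {S : Finset α} (h : S ∉ G a) (t : A → ℝ) :
    offWeight a G t S = ∑ q, if S ∈ G q then t q else 0 :=
  if_neg h

/-- The non-negative weights that vanish on `G a` and whose support forms a chain with `G a`. -/
def admissible [Fintype α] (a : A) (G : A → Finset (Finset α)) : Set (Finset α → ℝ) :=
  {w | (∀ S, 0 ≤ w S) ∧ (∀ S ∈ G a, w S = 0) ∧ (∀ S, w S ≠ 0 → S.Nonempty ∧ S ≠ Finset.univ) ∧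
    IsChain (· ≤ ·) ({S | w S ≠ 0} ∪ (G a : Set (Finset α)))}

theorem smul_mem_admissible [Fintype α] {w : Finset α → ℝ} (hw : w ∈ admissible a G) {c : ℝ} (hc : 0 ≤ c) :
    c • w ∈ admissible a G := by
  have hsub : ∀ S, (c • w) S ≠ 0 → w S ≠ 0 := fun S h => right_ne_zero_of_mul h
  refine ⟨fun S => mul_nonneg hc (hw.1 S), fun S hS => ?_, fun S hS => hw.2.2.1 S (hsub S hS), ?_⟩
  · simp [hw.2.1 S hS]
  · exact hw.2.2.2.mono (union_subset_union_left _ hsub)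

theorem offWeight_nonneg [Fintype A] {t : A → ℝ} (ht : ∀ q, 0 ≤ t q) (S : Finset α) :
    0 ≤ offWeight a G t S := by
  by_cases hS : S ∈ G a
  · exact (offWeight_of_mem hS t).ge
  · rw [offWeight_of_notMem hS]
    exact Finset.sum_nonneg fun q _ => by split_ifs <;> simp [ht]

theorem exists_of_offWeight_ne_zero [Fintype A] {t : A → ℝ} {S : Finset α} (hS : offWeight a G t S ≠ 0) :
    S ∉ G a ∧ ∃ q, t q ≠ 0 ∧ S ∈ G q := by
  have h1 : S ∉ G a := fun h => hS (offWeight_of_mem h t)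
  refine ⟨h1, ?_⟩
  rw [offWeight_of_notMem h1] at hS
  obtain ⟨q, -, hq⟩ := Finset.exists_ne_zero_of_sum_ne_zero hS
  by_cases hSq : S ∈ G q
  · exact ⟨q, by simpa [hSq] using hq, hSq⟩
  · simp [hSq] at hq

/-- For `S ∉ G a` the term `t a` does not contribute. With `exists_offWeight_eq`, this makes `1 - t
a` the largest weight when `t a ≠ 1`. -/
theorem offWeight_le [PartialOrder A] [Fintype A] {t : A → ℝ} (ht : t ∈ orderCone a) (S : Finset α) :
    offWeight a G t S ≤ 1 - t a := by
  obtain ⟨h0, h1, -, -⟩ := ht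
  by_cases hS : S ∈ G a
  · rw [offWeight_of_mem hS, sub_nonneg, ← h1]
    exact Finset.single_le_sum (fun q _ => h0 q) (Finset.mem_univ a)
  · rw [offWeight_of_notMem hS, le_sub_iff_add_le, ← h1]
    have h2 : t a = ∑ q, if q = a then t q else 0 := by simp
    rw [h2, ← Finset.sum_add_distrib]
    refine Finset.sum_le_sum fun q _ => ?_
    by_cases hq : q = a
    · subst hq
      simp [hS]
    · by_cases hSq : S ∈ G q <;> simp [hq, hSq, h0]

variable [PartialOrder A] [Fintype α]

theorem zero_mem_admissible (h : IsFlagLabeling a G π) : 0 ∈ admissible a G := by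
  refine ⟨fun S => le_rfl, fun S _ => rfl, fun S hS => absurd rfl hS, ?_⟩
  simpa using h.chain a le_rfl

variable [Fintype A]

theorem offWeight_mem_admissible (h : IsFlagLabeling a G π) {t : A → ℝ} (ht : t ∈ orderCone a) :
    offWeight a G t ∈ admissible a G := by
  obtain ⟨h0, -, hch, hle⟩ := ht
  have hex : ∀ S, S ∈ {S | offWeight a G t S ≠ 0} ∪ (G a : Set (Finset α)) →
      S ∈ G a ∨ ∃ q, t q ≠ 0 ∧ S ∈ G q := by
    rintro S (hS | hS)
    · exact Or.inr (exists_of_offWeight_ne_zero hS).2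
    · exact Or.inl hS
  refine ⟨offWeight_nonneg h0, fun S hS => offWeight_of_mem hS t, fun S hS => ?_, ?_⟩
  · obtain ⟨-, q, hq, hSq⟩ := exists_of_offWeight_ne_zero hS
    exact ⟨h.nonempty q (hle q hq) S hSq, h.ne_univ q (hle q hq) S hSq⟩
  · intro S hS T hT hne
    have hGa : ∀ q, t q ≠ 0 → G a ⊆ G q := fun q hq =>
      (h.le_iff q (hle q hq) a le_rfl).1 (hle q hq)
    have hGG : ∀ q q', t q ≠ 0 → t q' ≠ 0 → G q ⊆ G q' ∨ G q' ⊆ G q := by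
      intro q q' hq hq'
      rcases hch.total hq hq' with e | e
      · exact Or.inr ((h.le_iff q (hle q hq) q' (hle q' hq')).1 e)
      · exact Or.inl ((h.le_iff q' (hle q' hq') q (hle q hq)).1 e)
    rcases hex S hS with hS | ⟨q, hq, hS⟩ <;> rcases hex T hT with hT | ⟨q', hq', hT⟩
    · exact h.chain a le_rfl hS hT hne
    · exact h.chain q' (hle q' hq') (hGa q' hq' hS) hT hne
    · exact h.chain q (hle q hq) hS (hGa q hq hT) hne
    · rcases hGG q q' hq hq' with e | e
      · exact h.chain q' (hle q' hq') (e hS) hT hne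
      · exact h.chain q (hle q hq) hS (e hT) hne

theorem exists_offWeight_eq (h : IsFlagLabeling a G π) {t : A → ℝ} (ht : t ∈ orderCone a)
    (hta : t a ≠ 1) : ∃ S, offWeight a G t S = 1 - t a := by
  obtain ⟨h0, h1, hch, hle⟩ := ht
  have hne : (Finset.univ.filter fun q => t q ≠ 0 ∧ q ≠ a).Nonempty := by
    by_contra hemp
    rw [Finset.not_nonempty_iff_eq_empty, Finset.filter_eq_empty_iff] at hemp
    apply hta
    rw [← h1, Finset.sum_eq_single a]
    · intro q hq hqa
      by_contra hq0
      exact hemp hq ⟨hq0, hqa⟩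
    · simp
  -- The largest `q₀ ≠ a` in the support has the smallest flag, so a set in `G q₀` outside `G a` is
  -- counted by every `q ≠ a` in the support.
  obtain ⟨q₀, hq₀⟩ := Finset.exists_maximal hne
  have hm := hq₀.1
  simp only [Finset.mem_filter, Finset.mem_univ, true_and] at hm
  have hmax : ∀ q, t q ≠ 0 → q ≠ a → q ≤ q₀ := by
    intro q hq hqa
    rcases hch.total hq hm.1 with e | e
    · exact e
    · exact hq₀.2 (by simp [hq, hqa]) e
  have hnot : ¬ G q₀ ⊆ G a := fun hsub =>
    hm.2 (le_antisymm (hle _ hm.1) ((h.le_iff a le_rfl q₀ (hle _ hm.1)).2 hsub))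
  obtain ⟨S, hS, hSa⟩ := Finset.not_subset.1 hnot
  refine ⟨S, ?_⟩
  rw [offWeight_of_notMem hSa, eq_sub_iff_add_eq, ← h1]
  have h2 : t a = ∑ q, if q = a then t q else 0 := by simp
  rw [h2, ← Finset.sum_add_distrib]
  refine Finset.sum_congr rfl fun q _ => ?_
  by_cases hqa : q = a
  · subst hqa
    simp [hSa]
  · by_cases hq : t q = 0
    · simp [hq]
    · have : S ∈ G q := (h.le_iff q (hle q hq) q₀ (hle _ hm.1)).1 (hmax q hq hqa) hS
      simp [hqa, this]

theorem sum_le_offWeight (h : IsFlagLabeling a G π) {t : A → ℝ} (ht : t ∈ orderCone a) {q : A}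
    (hq : q ≤ a) {S : Finset α} (hS : S ∈ G q) (hSa : S ∉ G a) :
    (∑ q', if q' ≤ q then t q' else 0) ≤ offWeight a G t S := by
  rw [offWeight_of_notMem hSa]
  refine Finset.sum_le_sum fun q' _ => ?_
  by_cases hq' : q' ≤ q
  · have : S ∈ G q' := (h.le_iff q' (hq'.trans hq) q hq).1 hq' hS
    simp [hq', this]
  · simp only [hq', if_false]
    split_ifs <;> simp [ht.1 q']

/-- Take the smallest `q₀` in the support not below `q`, and `S` in `G q` but not in `G q₀`: the
support elements whose flag contains `S` are exactly those below `q`. With `sum_le_offWeight`, the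
partial sum is the minimum of `1` and the weights of `G q` outside `G a`. -/
theorem sum_eq_one_or_exists (h : IsFlagLabeling a G π) {t : A → ℝ} (ht : t ∈ orderCone a) {q : A}
    (hq : q ≤ a) : (∑ q', if q' ≤ q then t q' else 0) = 1 ∨
      ∃ S ∈ G q, S ∉ G a ∧ (∑ q', if q' ≤ q then t q' else 0) = offWeight a G t S := by
  obtain ⟨h0, h1, hch, hle⟩ := ht
  by_cases hne : (Finset.univ.filter fun q' => t q' ≠ 0 ∧ ¬ q' ≤ q).Nonempty
  · right
    obtain ⟨q₀, hq₀⟩ := Finset.exists_minimal hne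
    have hm := hq₀.1
    simp only [Finset.mem_filter, Finset.mem_univ, true_and] at hm
    have hmin : ∀ q', t q' ≠ 0 → ¬ q' ≤ q → q₀ ≤ q' := by
      intro q' hq' hqq'
      rcases hch.total hm.1 hq' with e | e
      · exact e
      · exact hq₀.2 (by simp [hq', hqq']) e
    have hq₀a := hle _ hm.1
    obtain ⟨S, hS, hSq₀⟩ := Finset.not_subset.1 fun hsub => hm.2 ((h.le_iff q₀ hq₀a q hq).2 hsub)
    have hSa : S ∉ G a := fun hSa => hSq₀ ((h.le_iff q₀ hq₀a a le_rfl).1 hq₀a hSa)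
    refine ⟨S, hS, hSa, ?_⟩
    rw [offWeight_of_notMem hSa]
    refine Finset.sum_congr rfl fun q' _ => ?_
    by_cases hq'0 : t q' = 0
    · simp [hq'0]
    · by_cases hq' : q' ≤ q
      · have : S ∈ G q' := (h.le_iff q' (hq'.trans hq) q hq).1 hq' hS
        simp [hq', this]
      · have : S ∉ G q' := fun hSq' =>
          hSq₀ ((h.le_iff q₀ hq₀a q' (hle _ hq'0)).1 (hmin q' hq'0 hq') hSq')
        simp [hq', this]
  · left
    rw [Finset.not_nonempty_iff_eq_empty, Finset.filter_eq_empty_iff] at hne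
    rw [← h1]
    refine Finset.sum_congr rfl fun q' hq' => ?_
    by_cases hq'0 : t q' = 0
    · simp [hq'0]
    · have : q' ≤ q := by
        by_contra hlt
        exact hne hq' ⟨hq'0, hlt⟩
      simp [this]

/-- The weights determine all sums of `t` over elements below `q ≤ a`, and these determine `t` by
induction on `q`. -/
theorem offWeight_injOn (h : IsFlagLabeling a G π) : InjOn (offWeight a G) (orderCone a) := by
  have hle : ∀ t ∈ orderCone a, ∀ t' ∈ orderCone a, offWeight a G t = offWeight a G t' →
      ∀ q ≤ a, (∑ q', if q' ≤ q then t' q' else 0) ≤ ∑ q', if q' ≤ q then t q' else 0 := by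
    intro t ht t' ht' hw q hq
    rcases h.sum_eq_one_or_exists ht hq with e | ⟨S, hS, hSa, e⟩
    · rw [e, ← ht'.2.1]
      refine Finset.sum_le_sum fun q' _ => ?_
      split_ifs <;> simp [ht'.1 q']
    · rw [e, hw]
      exact h.sum_le_offWeight ht' hq hS hSa
  intro t ht t' ht' hw
  have hzero : ∀ t ∈ orderCone a, ∀ q, ¬ q ≤ a → t q = 0 := by
    intro t ht q hq
    by_contra h0
    exact hq (ht.2.2.2 q h0)
  have hsplit : ∀ (t : A → ℝ) q, (∑ q', if q' ≤ q then t q' else 0) =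
      t q + ∑ q', if q' < q then t q' else 0 := by
    intro t q
    have h2 : t q = ∑ q', if q' = q then t q' else 0 := by simp
    rw [h2, ← Finset.sum_add_distrib]
    refine Finset.sum_congr rfl fun q' _ => ?_
    by_cases e : q' = q
    · subst e
      simp
    · by_cases e' : q' ≤ q
      · simp [e, e', lt_of_le_of_ne e' e]
      · have e'' : ¬ q' < q := fun hlt => e' hlt.le
        simp [e, e', e'']
  funext q
  induction q using WellFoundedLT.induction with
  | ind q ih =>
    by_cases hq : q ≤ a
    · have h1 := le_antisymm (hle t' ht' t ht hw.symm q hq) (hle t ht t' ht' hw q hq)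
      rw [hsplit, hsplit] at h1
      have h2 : (∑ q', if q' < q then t q' else 0) = ∑ q', if q' < q then t' q' else 0 := by
        refine Finset.sum_congr rfl fun q' _ => ?_
        split_ifs with hlt
        · exact ih q' hlt
        · rfl
      linarith
    · rw [hzero t ht q hq, hzero t' ht' q hq]

/-- Greedy peeling: give the smallest positive weight to the element whose flag is the whole support
together with `G a`, subtract, and recurse on a smaller support. What remains of the total mass `c`
at the end goes to `a`. The condition on flags keeps the chosen elements in a chain. -/
theorem exists_offWeight_eq_of_le (h : IsFlagLabeling a G π) {w : Finset α → ℝ}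
    (hw : w ∈ admissible a G) {c : ℝ} (hc : 0 ≤ c) (hwc : ∀ S, w S ≤ c) :
    ∃ t : A → ℝ, (∀ q, 0 ≤ t q) ∧ ∑ q, t q = c ∧ IsChain (· ≤ ·) {q | t q ≠ 0} ∧
      (∀ q, t q ≠ 0 → q ≤ a ∧ ∀ S ∈ G q, S ∉ G a → w S ≠ 0) ∧ offWeight a G t = w := by
  induction hn : (Finset.univ.filter fun S => w S ≠ 0).card using Nat.strong_induction_on
    generalizing w c with
  | _ n ih =>
  have hoff : ∀ q (x : ℝ) S, S ∉ G a →
      offWeight a G (Pi.single q x) S = if S ∈ G q then x else 0 := by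
    intro q x S hS
    rw [offWeight_of_notMem hS, Finset.sum_eq_single q]
    · simp
    · intro q' _ hq'
      simp [hq']
    · simp
  by_cases hne : (Finset.univ.filter fun S => w S ≠ 0).Nonempty
  · obtain ⟨S₀, hS₀, hmin⟩ := Finset.exists_min_image _ w hne
    have hS₀' : w S₀ ≠ 0 := by simpa using hS₀
    have hmin' : ∀ S, w S ≠ 0 → w S₀ ≤ w S := fun S hS => hmin S (by simpa using hS)
    obtain ⟨q, hq, hGq⟩ := h.exists_eq ((Finset.univ.filter fun S => w S ≠ 0) ∪ G a)
      Finset.subset_union_right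
      (by
        intro S hS
        rcases Finset.mem_union.1 hS with hS | hS
        · exact (hw.2.2.1 S (by simpa using hS)).1
        · exact h.nonempty a le_rfl S hS)
      (by
        intro S hS
        rcases Finset.mem_union.1 hS with hS | hS
        · exact (hw.2.2.1 S (by simpa using hS)).2
        · exact h.ne_univ a le_rfl S hS)
      (by simpa using hw.2.2.2)
    have hmem : ∀ S, S ∉ G a → (S ∈ G q ↔ w S ≠ 0) := by
      intro S hS
      simp [hGq, hS]
    set w' : Finset α → ℝ := fun S => if w S = 0 then 0 else w S - w S₀ with hw'
    have hsub : ∀ S, w' S ≠ 0 → w S ≠ 0 := by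
      intro S hS h0
      simp [hw', h0] at hS
    have hadm : w' ∈ admissible a G := by
      refine ⟨fun S => ?_, fun S hS => ?_, fun S hS => hw.2.2.1 S (hsub S hS), ?_⟩
      · by_cases h0 : w S = 0
        · simp [hw', h0]
        · simpa [hw', h0] using hmin' S h0
      · simp [hw', hw.2.1 S hS]
      · exact hw.2.2.2.mono (union_subset_union_left _ hsub)
    have hc' : ∀ S, w' S ≤ c - w S₀ := by
      intro S
      by_cases h0 : w S = 0
      · simpa [hw', h0] using hwc S₀
      · simpa [hw', h0] using hwc S
    have hcard : (Finset.univ.filter fun S => w' S ≠ 0).card < n := by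
      rw [← hn]
      refine Finset.card_lt_card ((Finset.ssubset_iff_of_subset fun S hS => ?_).2
        ⟨S₀, hS₀, by simp [hw']⟩)
      simpa using hsub S (by simpa using hS)
    obtain ⟨t, ht0, ht1, htc, htG, htw⟩ := ih _ hcard hadm (sub_nonneg.2 (hwc S₀)) hc' rfl
    have hqle : ∀ q', t q' ≠ 0 → q ≤ q' := by
      intro q' hq'
      rw [h.le_iff q hq q' (htG q' hq').1]
      intro S hS
      by_cases hSa : S ∈ G a
      · rw [hGq]
        exact Finset.mem_union_right _ hSa
      · exact (hmem S hSa).2 (hsub S ((htG q' hq').2 S hS hSa))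
    have hsupp : ∀ q', (t + Pi.single q (w S₀) : A → ℝ) q' ≠ 0 → q' = q ∨ t q' ≠ 0 := by
      intro q' hq'
      by_cases e : q' = q
      · exact Or.inl e
      · right
        simpa [e] using hq'
    refine ⟨t + Pi.single q (w S₀), fun q' => ?_, ?_, ?_, ?_, ?_⟩
    · refine add_nonneg (ht0 q') ?_
      by_cases e : q' = q
      · subst e
        simpa using hw.1 S₀
      · simp [e]
    · simp [Finset.sum_add_distrib, ht1]
    · intro x hx y hy hxy
      rcases hsupp x hx with ex | hx <;> rcases hsupp y hy with ey | hy
      · exact absurd (ex.trans ey.symm) hxy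
      · exact Or.inl (ex ▸ hqle y hy)
      · exact Or.inr (ey ▸ hqle x hx)
      · exact htc hx hy hxy
    · intro q' hq'
      rcases hsupp q' hq' with rfl | hq'
      · exact ⟨hq, fun S hS hSa => (hmem S hSa).1 hS⟩
      · exact ⟨(htG q' hq').1, fun S hS hSa => hsub S ((htG q' hq').2 S hS hSa)⟩
    · rw [map_add, htw]
      funext S
      by_cases hSa : S ∈ G a
      · simp [hw', offWeight_of_mem hSa, hw.2.1 S hSa]
      · rw [Pi.add_apply, hoff q _ S hSa]
        simp only [hmem S hSa, hw']
        by_cases h0 : w S = 0 <;> simp [h0]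
  · rw [Finset.not_nonempty_iff_eq_empty, Finset.filter_eq_empty_iff] at hne
    have hw0 : ∀ S, w S = 0 := fun S => not_not.1 (hne (Finset.mem_univ S))
    have hsupp : ∀ q, (Pi.single a c : A → ℝ) q ≠ 0 → q = a := by
      intro q hq
      by_contra e
      simp [e] at hq
    refine ⟨Pi.single a c, fun q => ?_, by simp, ?_, ?_, ?_⟩
    · by_cases e : q = a
      · subst e
        simpa using hc
      · simp [e]
    · intro x hx y hy hxy
      exact absurd ((hsupp x hx).trans (hsupp y hy).symm) hxy
    · intro q hq
      obtain rfl := hsupp q hq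
      exact ⟨le_rfl, fun S hS hSa => absurd hS hSa⟩
    · funext S
      by_cases hSa : S ∈ G a
      · simp [offWeight_of_mem hSa, hw0]
      · rw [hoff a c S hSa, hw0]
        simp [hSa]

theorem exists_mem_orderCone (h : IsFlagLabeling a G π) {w : Finset α → ℝ}
    (hw : w ∈ admissible a G) (hw1 : ∀ S, w S ≤ 1) :
    ∃ t ∈ orderCone a, offWeight a G t = w := by
  obtain ⟨t, h0, h1, hch, hle, hwt⟩ := h.exists_offWeight_eq_of_le hw zero_le_one hw1
  exact ⟨t, ⟨h0, h1, hch, fun q hq => (hle q hq).1⟩, hwt⟩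

end IsFlagLabeling

end OrderComplexCells

/-! ### Admissible weights as coordinates on a Euclidean space -/

section Layers

open Metric Set
open scoped Classical

/-- `D` is the quotient by the `m`-dimensional space of functions factoring through `π`, in
coordinates. -/
theorem exists_linearMap_ker_comp {α : Type*} [Fintype α] {m k : ℕ} {π : α → Fin m}
    (hπ : Function.Surjective π) (hk : k + m = Fintype.card α) :
    ∃ D : (α → ℝ) →ₗ[ℝ] (Fin k → ℝ), Function.Surjective D ∧
      ∀ f, D f = 0 ↔ ∀ i j, π i = π j → f i = f j := by
  let P : (Fin m → ℝ) →ₗ[ℝ] (α → ℝ) := LinearMap.funLeft ℝ ℝ π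
  have hP : Function.Injective P := LinearMap.funLeft_injective_of_surjective ℝ ℝ π hπ
  have h1 : Module.finrank ℝ (LinearMap.range P) = m := by
    rw [LinearMap.finrank_range_of_inj hP, Module.finrank_fin_fun]
  have h2 : Module.finrank ℝ ((α → ℝ) ⧸ LinearMap.range P) = Module.finrank ℝ (Fin k → ℝ) := by
    have h3 := Submodule.finrank_quotient_add_finrank (LinearMap.range P)
    rw [h1, Module.finrank_fintype_fun_eq_card] at h3
    rw [Module.finrank_fin_fun]
    omega
  let e := LinearEquiv.ofFinrankEq _ _ h2
  refine ⟨e.toLinearMap.comp (LinearMap.range P).mkQ,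
    e.surjective.comp (Submodule.mkQ_surjective _), fun f => ?_⟩
  rw [LinearMap.comp_apply, LinearEquiv.coe_coe, e.map_eq_zero_iff, Submodule.mkQ_apply,
    Submodule.Quotient.mk_eq_zero]
  constructor
  · rintro ⟨g, rfl⟩ i j hij
    change g (π i) = g (π j)
    rw [hij]
  · intro hf
    refine ⟨fun b => f (Function.surjInv hπ b), ?_⟩
    funext i
    exact hf _ _ (Function.surjInv_eq hπ _)

/-- The combination of the indicator functions of the subsets of `α` with given weights. -/
noncomputable def layerSum (α : Type*) [Fintype α] : (Finset α → ℝ) →ₗ[ℝ] (α → ℝ) where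
  toFun w i := ∑ S, if i ∈ S then w S else 0
  map_add' w w' := by
    funext i
    simp only [Pi.add_apply, ← Finset.sum_add_distrib]
    refine Finset.sum_congr rfl fun q _ => ?_
    split_ifs <;> simp
  map_smul' c w := by
    funext i
    simp only [Pi.smul_apply, smul_eq_mul, Finset.mul_sum, RingHom.id_apply]
    refine Finset.sum_congr rfl fun q _ => ?_
    split_ifs <;> simp

variable {α : Type*} [Fintype α]

theorem layerSum_apply (w : Finset α → ℝ) (i : α) :
    layerSum α w i = ∑ S, if i ∈ S then w S else 0 := rfl

theorem layerSum_single (S : Finset α) (c : ℝ) (i : α) :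
    layerSum α (Pi.single S c) i = if i ∈ S then c else 0 := by
  rw [layerSum_apply, Finset.sum_eq_single S]
  · simp
  · intro T _ hT
    simp [hT]
  · simp

/-- A function on a finite set is a constant plus a non-negative combination of indicator functions
of proper superlevel sets. -/
theorem exists_layerSum_eq (x : α → ℝ) : ∃ (w : Finset α → ℝ) (c : ℝ), (∀ S, 0 ≤ w S) ∧
    (∀ S, w S ≠ 0 → S.Nonempty ∧ S ≠ Finset.univ ∧ ∃ v, ∀ j, j ∈ S ↔ v ≤ x j) ∧
    ∀ i, x i = c + layerSum α w i := by
  induction hn : (Finset.univ.image x).card using Nat.strong_induction_on generalizing x with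
  | _ n ih =>
  by_cases hc : ∃ c, ∀ i, x i = c
  · obtain ⟨c, hc⟩ := hc
    refine ⟨0, c, fun S => le_rfl, fun S hS => absurd rfl hS, fun i => ?_⟩
    rw [map_zero, hc]
    simp
  · have hα : Nonempty α := by
      by_contra hα
      rw [not_nonempty_iff] at hα
      exact hc ⟨0, fun i => (hα.false i).elim⟩
    obtain ⟨i₀, hi₀⟩ := Finite.exists_max x
    have hne : (Finset.univ.filter fun i => x i ≠ x i₀).Nonempty := by
      by_contra hemp
      rw [Finset.not_nonempty_iff_eq_empty, Finset.filter_eq_empty_iff] at hemp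
      exact hc ⟨x i₀, fun i => not_not.1 (hemp (Finset.mem_univ i))⟩
    obtain ⟨i₁, hi₁, hmax⟩ := Finset.exists_max_image _ x hne
    have hi₁' : x i₁ ≠ x i₀ := by simpa using hi₁
    have hlt : x i₁ < x i₀ := lt_of_le_of_ne (hi₀ i₁) hi₁'
    have hdich : ∀ i, x i = x i₀ ∨ x i ≤ x i₁ := fun i => by
      by_cases e : x i = x i₀
      · exact Or.inl e
      · exact Or.inr (hmax i (by simpa using e))
    -- Lower the top value to the second largest one: one value fewer remains, and the difference is
    -- a multiple of the indicator of the top level set.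
    set x' : α → ℝ := fun i => min (x i) (x i₁) with hx'
    have hx'mem : ∀ i, x' i ∈ (Finset.univ.image x).erase (x i₀) := by
      intro i
      rw [Finset.mem_erase]
      rcases hdich i with e | e
      · simp only [hx', e, min_eq_right hlt.le]
        exact ⟨hi₁', Finset.mem_image_of_mem x (Finset.mem_univ _)⟩
      · simp only [hx', min_eq_left e]
        exact ⟨(e.trans_lt hlt).ne, Finset.mem_image_of_mem x (Finset.mem_univ _)⟩
    have hcard : (Finset.univ.image x').card < n := by
      rw [← hn]
      refine lt_of_le_of_lt (Finset.card_le_card ?_) (Finset.card_erase_lt_of_mem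
        (Finset.mem_image_of_mem x (Finset.mem_univ i₀)))
      intro v hv
      obtain ⟨i, -, rfl⟩ := Finset.mem_image.1 hv
      exact hx'mem i
    obtain ⟨w, c, hw0, hwS, hw⟩ := ih _ hcard x' rfl
    set T : Finset α := Finset.univ.filter fun i => x i₀ ≤ x i with hT
    refine ⟨w + Pi.single T (x i₀ - x i₁), c, fun S => ?_, fun S hS => ?_, fun i => ?_⟩
    · refine add_nonneg (hw0 S) ?_
      by_cases e : S = T
      · subst e
        simpa using hlt.le
      · simp [e]
    · by_cases e : S = T
      · subst e
        refine ⟨⟨i₀, by simp [hT]⟩, fun hu => ?_, x i₀, fun j => by simp [hT]⟩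
        have : i₁ ∈ T := by
          rw [hu]
          exact Finset.mem_univ _
        simp only [hT, Finset.mem_filter, Finset.mem_univ, true_and] at this
        exact absurd this (not_le.2 hlt)
      · have hS' : w S ≠ 0 := by simpa [e] using hS
        obtain ⟨hSn, hSu, v, hv⟩ := hwS S hS'
        refine ⟨hSn, hSu, v, fun j => ?_⟩
        rw [hv]
        obtain ⟨i, hi⟩ := hSn
        have hvi : v ≤ x i₁ := ((hv i).1 hi).trans (min_le_right _ _)
        simp [hx', hvi]
    · rw [map_add, Pi.add_apply, layerSum_single, ← add_assoc, ← hw i]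
      rcases hdich i with e | e
      · simp [hx', hT, e, hlt.le]
      · have h1 : ¬ x i₀ ≤ x i := not_le.2 (e.trans_lt hlt)
        simp [hx', hT, h1, e]

namespace IsFlagLabeling

variable {A : Type*} [PartialOrder A] {m : ℕ} {a : A}
  {G : A → Finset (Finset α)} {π : α → Fin m}

/-- If `π i < π j`, the upper set generated by `j` belongs to `G a` and separates `i` from `j`. -/
theorem eq_of_forall_mem_iff (h : IsFlagLabeling a G π) {i j : α}
    (hij : ∀ S ∈ G a, i ∈ S ↔ j ∈ S) : π i = π j := by
  have key : ∀ i j, (∀ S ∈ G a, i ∈ S ↔ j ∈ S) → π j ≤ π i := by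
    intro i j hij
    by_contra hlt
    rw [not_le] at hlt
    have hS : (Finset.univ.filter fun k => π j ≤ π k) ∈ G a := by
      rw [h.mem_iff]
      refine ⟨⟨j, by simp⟩, fun hu => ?_, fun k hk l hkl => ?_⟩
      · have : i ∈ (Finset.univ.filter fun k => π j ≤ π k) := by
          rw [hu]
          exact Finset.mem_univ _
        simp only [Finset.mem_filter, Finset.mem_univ, true_and] at this
        exact absurd this (not_le.2 hlt)
      · simp only [Finset.mem_filter, Finset.mem_univ, true_and] at hk ⊢
        exact hk.trans hkl
    have := (hij _ hS).2 (by simp)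
    simp only [Finset.mem_filter, Finset.mem_univ, true_and] at this
    exact absurd this (not_le.2 hlt)
  exact le_antisymm (key j i fun S hS => (hij S hS).symm) (key i j hij)

/-- A chain of sets not containing `S` fails to separate some element of `S` from some element
outside `S`. -/
theorem exists_not_separated {C : Finset (Finset α)}
    (hC : IsChain (· ≤ ·) (C : Set (Finset α))) {S : Finset α} (hS : S ∉ C) (hne : S.Nonempty)
    (hu : S ≠ Finset.univ) : ∃ i ∈ S, ∃ j ∉ S, ∀ T ∈ C, i ∈ T → j ∈ T := by
  by_contra hcon
  push Not at hcon
  obtain ⟨j₀, hj₀⟩ : ∃ j, j ∉ S := by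
    by_contra hall
    push Not at hall
    exact hu (Finset.eq_univ_iff_forall.2 hall)
  -- If every such pair were separated, the smallest member of `C` containing `i` would avoid every
  -- `j ∉ S`. The largest member of `C` inside `S` would then be `S` itself.
  have h1 : ∀ i ∈ S, ∃ T ∈ C, i ∈ T ∧ T ⊆ S := by
    intro i hi
    have hne : (C.filter fun T => i ∈ T).Nonempty := by
      obtain ⟨T, hT, hiT, -⟩ := hcon i hi j₀ hj₀
      exact ⟨T, by simp [hT, hiT]⟩
    obtain ⟨T, hT⟩ := Finset.exists_minimal hne
    have hTC := Finset.mem_filter.1 hT.1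
    refine ⟨T, hTC.1, hTC.2, fun j hj => ?_⟩
    by_contra hjS
    obtain ⟨T', hT', hiT', hjT'⟩ := hcon i hi j hjS
    rcases hC.total hTC.1 hT' with e | e
    · exact hjT' (e hj)
    · exact hjT' (hT.2 (by simp [hT', hiT']) e hj)
  have hne : (C.filter fun T => T ⊆ S).Nonempty := by
    obtain ⟨i, hi⟩ := hne
    obtain ⟨T, hT, -, hTS⟩ := h1 i hi
    exact ⟨T, by simp [hT, hTS]⟩
  obtain ⟨T, hT⟩ := Finset.exists_maximal hne
  have hTC := Finset.mem_filter.1 hT.1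
  have hST : S ⊆ T := by
    intro i hi
    obtain ⟨T', hT', hiT', hT'S⟩ := h1 i hi
    rcases hC.total hTC.1 hT' with e | e
    · exact hT.2 (by simp [hT', hT'S]) e hiT'
    · exact e hiT'
  exact hS (Finset.Subset.antisymm hST hTC.2 ▸ hTC.1)

/-- Choose `i ∈ S`, `j ∉ S` such that no set other than `S` in the chain of `w'` and `G a` contains
`i` but not `j`. Then `π i = π j`, and the difference of layer sums at `i` and `j` is at least `w S`
for `w` and at most `w' S` for `w'`. -/
theorem le_of_layerSum_sub_eq (h : IsFlagLabeling a G π) {w w' : Finset α → ℝ}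
    (hw : w ∈ admissible a G) (hw' : w' ∈ admissible a G)
    (heq : ∀ i j, π i = π j →
      layerSum α w i - layerSum α w j = layerSum α w' i - layerSum α w' j) (S : Finset α) :
    w S ≤ w' S := by
  by_cases hS0 : w S = 0
  · rw [hS0]
    exact hw'.1 S
  have hSa : S ∉ G a := fun hS => hS0 (hw.2.1 S hS)
  have hcomp : ∀ T, (w T ≠ 0 ∨ T ∈ G a) → S ≤ T ∨ T ≤ S := fun T hT =>
    hw.2.2.2.total (Or.inl hS0) hT
  obtain ⟨i, hi, j, hj, hij⟩ := exists_not_separated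
    (C := ((Finset.univ.filter fun T => w' T ≠ 0) ∪ G a).erase S)
    (hw'.2.2.2.mono (by
      intro T hT
      have := (Finset.mem_erase.1 (Finset.mem_coe.1 hT)).2
      simpa using this))
    (by simp) (hw.2.2.1 S hS0).1 (hw.2.2.1 S hS0).2
  have hπ : π i = π j := by
    refine h.eq_of_forall_mem_iff fun T hT => ⟨fun hiT => ?_, fun hjT => ?_⟩
    · refine hij T (Finset.mem_erase.2 ⟨?_, Finset.mem_union_right _ hT⟩) hiT
      rintro rfl
      exact hSa hT
    · rcases hcomp T (Or.inr hT) with e | e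
      · exact e hi
      · exact absurd (e hjT) hj
  have hdiff : ∀ w : Finset α → ℝ, layerSum α w i - layerSum α w j =
      ∑ T, ((if i ∈ T then w T else 0) - if j ∈ T then w T else 0) := fun w => by
    rw [Finset.sum_sub_distrib]
    rfl
  have h1 : w S ≤ layerSum α w i - layerSum α w j := by
    rw [hdiff]
    have h2 : w S = (if i ∈ S then w S else 0) - if j ∈ S then w S else 0 := by simp [hi, hj]
    conv_lhs => rw [h2]
    refine Finset.single_le_sum (f := fun T => (if i ∈ T then w T else 0) -
      if j ∈ T then w T else 0) (fun T _ => ?_) (Finset.mem_univ S)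
    by_cases hT : w T = 0
    · simp [hT]
    · rcases hcomp T (Or.inl hT) with e | e
      · have hiT : i ∈ T := e hi
        by_cases hjT : j ∈ T <;> simp [hiT, hjT, hw.1 T]
      · have hjT : j ∉ T := fun hjT => hj (e hjT)
        by_cases hiT : i ∈ T <;> simp [hiT, hjT, hw.1 T]
  have h2 : layerSum α w' i - layerSum α w' j ≤ w' S := by
    rw [hdiff, ← Finset.add_sum_erase _ _ (Finset.mem_univ S)]
    have h3 : ∑ T ∈ Finset.univ.erase S, ((if i ∈ T then w' T else 0) -
        if j ∈ T then w' T else 0) ≤ 0 := by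
      refine Finset.sum_nonpos fun T hT => ?_
      by_cases hT0 : w' T = 0
      · simp [hT0]
      · have hT' := hij T (by simp [Finset.ne_of_mem_erase hT, hT0])
        by_cases hiT : i ∈ T
        · simp [hiT, hT' hiT]
        · by_cases hjT : j ∈ T <;> simp [hiT, hjT, hw'.1 T]
    simp only [hi, hj, if_true, if_false, sub_zero]
    linarith
  linarith [heq i j hπ]

theorem layerSum_injOn (h : IsFlagLabeling a G π) {k : ℕ} {D : (α → ℝ) →ₗ[ℝ] (Fin k → ℝ)}
    (hD : ∀ f, D f = 0 ↔ ∀ i j, π i = π j → f i = f j) :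
    InjOn (D ∘ₗ layerSum α) (admissible a G) := by
  intro w hw w' hw' heq
  have h1 : D (layerSum α w - layerSum α w') = 0 := by
    rw [map_sub, sub_eq_zero]
    exact heq
  rw [hD] at h1
  have h2 : ∀ i j, π i = π j →
      layerSum α w i - layerSum α w j = layerSum α w' i - layerSum α w' j := by
    intro i j hij
    have := h1 i j hij
    simp only [Pi.sub_apply] at this
    linarith
  funext S
  exact le_antisymm (h.le_of_layerSum_sub_eq hw hw' h2 S)
    (h.le_of_layerSum_sub_eq hw' hw (fun i j hij => (h2 i j hij).symm) S)

/-- Lift `y` to a function, make it increase strictly along `π` without changing its class, and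
decompose it into layers. All layers are superlevel sets, hence form a chain with `G a`. -/
theorem exists_admissible (h : IsFlagLabeling a G π) {k : ℕ} {D : (α → ℝ) →ₗ[ℝ] (Fin k → ℝ)}
    (hDs : Function.Surjective D) (hD : ∀ f, D f = 0 ↔ ∀ i j, π i = π j → f i = f j)
    (y : Fin k → ℝ) : ∃ w ∈ admissible a G, (D ∘ₗ layerSum α) w = y := by
  obtain ⟨x₀, rfl⟩ := hDs y
  obtain ⟨N, hN⟩ : ∃ N : ℝ, ∀ i j, x₀ i - x₀ j < N := by
    obtain ⟨N, hN⟩ := (Set.finite_range fun p : α × α => x₀ p.1 - x₀ p.2).bddAbove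
    exact ⟨N + 1, fun i j => lt_of_le_of_lt (hN ⟨(i, j), rfl⟩) (lt_add_one N)⟩
  -- `N` exceeds the oscillation of `x₀`, and the added function is killed by `D`.
  set x : α → ℝ := x₀ + fun i => N * ((π i : ℕ) : ℝ) with hx
  have hlt : ∀ i j, π i < π j → x i < x j := by
    intro i j hij
    have h1 : ((π i : ℕ) : ℝ) + 1 ≤ ((π j : ℕ) : ℝ) := by exact_mod_cast hij
    have h2 := hN i j
    have h3 : 0 < N := by
      have := hN i i
      simpa using this
    have h4 := mul_le_mul_of_nonneg_left h1 h3.le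
    simp only [hx, Pi.add_apply]
    linarith
  obtain ⟨w₀, c, hw0, hwS, hw⟩ := exists_layerSum_eq x
  -- Indicators of members of `G a` are constant on the fibres of `π`, so dropping them does not
  -- change the image under `D`.
  set w : Finset α → ℝ := fun S => if S ∈ G a then 0 else w₀ S with hwdef
  have hsub : ∀ S, w S ≠ 0 → w₀ S ≠ 0 := by
    intro S hS h0
    simp [hwdef, h0] at hS
  have hupper : ∀ S, S ∈ ({S | w S ≠ 0} ∪ (G a : Set (Finset α))) →
      ∀ i ∈ S, ∀ j, x i ≤ x j → j ∈ S := by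
    rintro S (hS | hS) i hi j hij
    · obtain ⟨-, -, v, hv⟩ := hwS S (hsub S hS)
      exact (hv j).2 (((hv i).1 hi).trans hij)
    · exact ((h.mem_iff S).1 hS).2.2 i hi j
        (not_lt.1 fun hlt' => absurd hij (not_le.2 (hlt j i hlt')))
  refine ⟨w, ⟨fun S => ?_, fun S hS => if_pos hS, fun S hS => ?_, ?_⟩, ?_⟩
  · by_cases hS : S ∈ G a <;> simp [hwdef, hS, hw0]
  · obtain ⟨h1, h2, -⟩ := hwS S (hsub S hS)
    exact ⟨h1, h2⟩
  · intro S hS T hT _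
    by_contra hcon
    push Not at hcon
    obtain ⟨i, hiS, hiT⟩ := Finset.not_subset.1 hcon.1
    obtain ⟨j, hjT, hjS⟩ := Finset.not_subset.1 hcon.2
    rcases le_total (x i) (x j) with e | e
    · exact hjS (hupper S hS i hiS j e)
    · exact hiT (hupper T hT j hjT i e)
  · rw [LinearMap.comp_apply, ← sub_eq_zero, ← map_sub, hD]
    intro i j hij
    have h1 : ∀ i, layerSum α w i - x₀ i = N * ((π i : ℕ) : ℝ) - c -
        ∑ S, if i ∈ S then (if S ∈ G a then w₀ S else 0) else 0 := by
      intro i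
      have h2 : x₀ i = x i - N * ((π i : ℕ) : ℝ) := by simp [hx]
      have h3 : layerSum α w₀ i = layerSum α w i +
          ∑ S, if i ∈ S then (if S ∈ G a then w₀ S else 0) else 0 := by
        rw [layerSum_apply, layerSum_apply, ← Finset.sum_add_distrib]
        refine Finset.sum_congr rfl fun S _ => ?_
        by_cases hi : i ∈ S <;> by_cases hS : S ∈ G a <;> simp [hi, hS, hwdef]
      rw [h2, hw i, h3]
      ring
    simp only [Pi.sub_apply]
    rw [h1, h1, hij]
    congr 1
    refine Finset.sum_congr rfl fun S _ => ?_
    by_cases hS : S ∈ G a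
    · have hmem := ((h.mem_iff S).1 hS).2.2
      have : i ∈ S ↔ j ∈ S := ⟨fun hi => hmem i hi j hij.le, fun hj => hmem j hj i hij.ge⟩
      simp [this]
    · simp [hS]

end IsFlagLabeling

end Layers

/-! ### Cells of the order complex are balls -/

section Charts

open Metric Set
open scoped Classical

variable {A α : Type*} [PartialOrder A] [Fintype A] [Fintype α] {m : ℕ} {a : A}
  {G : A → Finset (Finset α)} {π : α → Fin m}

/-- The cell of the order complex below an element with a flag labeling is a ball, in which the
distance from the boundary is the coordinate of that element. -/
theorem IsFlagLabeling.exists_chart (h : IsFlagLabeling a G π) (hπ : Function.Surjective π) {k : ℕ}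
    (hk : k + m = Fintype.card α) : ∃ ρ : (A → ℝ) → (Fin k → ℝ), ContinuousOn ρ (orderCone a) ∧
      InjOn ρ (orderCone a) ∧ ρ '' orderCone a = closedBall 0 1 ∧
      ∀ t ∈ orderCone a, ‖ρ t‖ = 1 - t a := by
  obtain ⟨D, hDs, hD⟩ := exists_linearMap_ker_comp hπ hk
  have hLi := h.layerSum_injOn hD
  have hLs := h.exists_admissible hDs hD
  set L := D ∘ₗ layerSum α
  set off := offWeight a G with hoff
  have hadm : ∀ t ∈ orderCone a, off t ∈ admissible a G := fun t ht =>
    h.offWeight_mem_admissible ht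
  have hle1 : ∀ t ∈ orderCone a, t a ≤ 1 := by
    intro t ht
    rw [← ht.2.1]
    exact Finset.single_le_sum (fun q _ => ht.1 q) (Finset.mem_univ a)
  have hLne : ∀ t ∈ orderCone a, t a ≠ 1 → L (off t) ≠ 0 := by
    intro t ht hta h0
    have h1 : off t = 0 := hLi (hadm t ht) h.zero_mem_admissible (by rw [h0, map_zero])
    obtain ⟨S, hS⟩ := h.exists_offWeight_eq ht hta
    have h2 : off t S = 1 - t a := hS
    rw [h1] at h2
    exact hta (sub_eq_zero.1 h2.symm).symm
  have hoff0 : ∀ t ∈ orderCone a, t a = 1 → off t = 0 := by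
    intro t ht hta
    funext S
    refine le_antisymm ?_ (offWeight_nonneg ht.1 S)
    have := offWeight_le (G := G) ht S
    rwa [hta, sub_self] at this
  -- Radial rescaling to norm `1 - t a`. At the cone point `t a = 1` both factors vanish, so
  -- division by zero does no harm, and continuity there follows from the norm.
  set ρ : (A → ℝ) → (Fin k → ℝ) := fun t => ((1 - t a) / ‖L (off t)‖) • L (off t) with hρ
  have hnorm : ∀ t ∈ orderCone a, ‖ρ t‖ = 1 - t a := by
    intro t ht
    by_cases hta : t a = 1
    · simp [hρ, hta]
    · have h1 := norm_ne_zero_iff.2 (hLne t ht hta)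
      simp only [hρ]
      rw [norm_smul, norm_div, norm_norm, div_mul_cancel₀ _ h1, Real.norm_eq_abs,
        abs_of_nonneg (sub_nonneg.2 (hle1 t ht))]
  have hcont : Continuous fun t => L (off t) :=
    (L ∘ₗ off).continuous_of_finiteDimensional
  refine ⟨ρ, ?_, ?_, ?_, hnorm⟩
  · intro t ht
    by_cases hta : t a = 1
    · have h0 : ρ t = 0 := by rw [← norm_eq_zero, hnorm t ht, hta, sub_self]
      rw [ContinuousWithinAt, h0, tendsto_zero_iff_norm_tendsto_zero]
      have h1 : Filter.Tendsto (fun t : A → ℝ => 1 - t a) (nhdsWithin t (orderCone a)) (nhds 0) := by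
        have h2 : Continuous fun t : A → ℝ => 1 - t a := by fun_prop
        have h3 := (h2.tendsto t).mono_left (nhdsWithin_le_nhds (s := orderCone a))
        rwa [hta, sub_self] at h3
      refine h1.congr' ?_
      filter_upwards [self_mem_nhdsWithin] with t' ht'
      exact (hnorm t' ht').symm
    · refine ContinuousAt.continuousWithinAt ?_
      refine ContinuousAt.smul (ContinuousAt.div ?_ hcont.norm.continuousAt ?_) hcont.continuousAt
      · exact (continuous_const.sub (continuous_apply a)).continuousAt
      · exact norm_ne_zero_iff.2 (hLne t ht hta)
  · intro t ht t' ht' heq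
    refine h.offWeight_injOn ht ht' ?_
    have hta : t a = t' a := by
      have h1 := hnorm t ht
      rw [heq, hnorm t' ht'] at h1
      linarith
    by_cases h1 : t a = 1
    · exact (hoff0 t ht h1).trans (hoff0 t' ht' (hta ▸ h1)).symm
    have h1' : t' a ≠ 1 := hta ▸ h1
    -- Points with equal image have proportional weights; their largest weights are both `1 - t a`,
    -- so the factor is `1`.
    have key : ∀ t ∈ orderCone a, ∀ t' ∈ orderCone a, t a ≠ 1 → t a = t' a → ∀ c : ℝ, 0 ≤ c →
        off t = c • off t' → 1 ≤ c := by
      intro t ht t' ht' h1 hta c hc hcw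
      obtain ⟨S, hS⟩ := h.exists_offWeight_eq ht h1
      have h2 : off t S = 1 - t a := hS
      have h3 : off t' S ≤ 1 - t' a := offWeight_le ht' S
      rw [hcw, Pi.smul_apply, smul_eq_mul] at h2
      have h4 := mul_le_mul_of_nonneg_left h3 hc
      rw [h2, ← hta] at h4
      have h5 : 0 < 1 - t a := sub_pos.2 (lt_of_le_of_ne (hle1 t ht) h1)
      exact le_of_mul_le_mul_right (by linarith) h5
    have hpos : ∀ t ∈ orderCone a, t a ≠ 1 → 0 < (1 - t a) / ‖L (off t)‖ := fun t ht h1 =>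
      div_pos (sub_pos.2 (lt_of_le_of_ne (hle1 t ht) h1)) (norm_pos_iff.2 (hLne t ht h1))
    set x := (1 - t a) / ‖L (off t)‖ with hx
    set x' := (1 - t' a) / ‖L (off t')‖ with hx'
    have hxp : 0 < x := hpos t ht h1
    have hxp' : 0 < x' := hpos t' ht' h1'
    have heq' : x • off t = x' • off t' := by
      refine hLi (smul_mem_admissible (hadm t ht) hxp.le)
        (smul_mem_admissible (hadm t' ht') hxp'.le) ?_
      rw [map_smul, map_smul]
      exact heq
    have e1 : off t = (x' / x) • off t' := by
      rw [div_eq_inv_mul, mul_smul, ← heq', smul_smul, inv_mul_cancel₀ hxp.ne', one_smul]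
    have e2 : off t' = (x / x') • off t := by
      rw [div_eq_inv_mul, mul_smul, heq', smul_smul, inv_mul_cancel₀ hxp'.ne', one_smul]
    have c1 := key t ht t' ht' h1 hta _ (div_nonneg hxp'.le hxp.le) e1
    have c2 := key t' ht' t ht h1' hta.symm _ (div_nonneg hxp.le hxp'.le) e2
    rw [le_div_iff₀ hxp, one_mul] at c1
    rw [le_div_iff₀ hxp', one_mul] at c2
    rw [e1, le_antisymm c2 c1, div_self hxp.ne', one_smul]
  · apply Subset.antisymm
    · rintro _ ⟨t, ht, rfl⟩
      rw [mem_closedBall_zero_iff, hnorm t ht]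
      linarith [ht.1 a]
    · intro y hy
      rw [mem_closedBall_zero_iff] at hy
      by_cases hy0 : y = 0
      · obtain ⟨t, ht, hwt⟩ := h.exists_mem_orderCone h.zero_mem_admissible
          (fun S => by simp)
        refine ⟨t, ht, ?_⟩
        simp only [hρ, hoff, hwt, map_zero, smul_zero, hy0]
      · obtain ⟨w, hw, hwy⟩ := hLs y
        have hwne : ∃ S, w S ≠ 0 := by
          by_contra hcon
          push Not at hcon
          have : w = 0 := funext hcon
          rw [this, map_zero] at hwy
          exact hy0 hwy.symm
        obtain ⟨S₁, hS₁⟩ := hwne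
        obtain ⟨S₀, hS₀⟩ := Finite.exists_max w
        have hM : 0 < w S₀ := lt_of_lt_of_le (lt_of_le_of_ne (hw.1 S₁) hS₁.symm) (hS₀ S₁)
        -- The scaling that makes the largest weight equal to `‖y‖`, as `1 - t a` must be.
        have hc : 0 < ‖y‖ / w S₀ := div_pos (norm_pos_iff.2 hy0) hM
        have hmax : ∀ S, ((‖y‖ / w S₀) • w) S ≤ ‖y‖ := by
          intro S
          rw [Pi.smul_apply, smul_eq_mul, div_mul_eq_mul_div, div_le_iff₀ hM]
          exact mul_le_mul_of_nonneg_left (hS₀ S) (norm_nonneg y)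
        have hatt : ((‖y‖ / w S₀) • w) S₀ = ‖y‖ := by
          rw [Pi.smul_apply, smul_eq_mul, div_mul_cancel₀ _ hM.ne']
        obtain ⟨t, ht, hwt⟩ := h.exists_mem_orderCone (smul_mem_admissible hw hc.le)
          (fun S => (hmax S).trans hy)
        have hwt' : off t = (‖y‖ / w S₀) • w := hwt
        have hge : ‖y‖ ≤ 1 - t a := by
          have := offWeight_le (G := G) ht S₀
          rwa [hwt, hatt] at this
        have hta : t a ≠ 1 := by
          intro e
          rw [e, sub_self] at hge
          exact absurd (norm_pos_iff.2 hy0) (not_lt.2 hge)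
        have hle : 1 - t a ≤ ‖y‖ := by
          obtain ⟨S, hS⟩ := h.exists_offWeight_eq ht hta
          rw [← hS, hwt]
          exact hmax S
        refine ⟨t, ht, ?_⟩
        have hy' := norm_ne_zero_iff.2 hy0
        simp only [hρ, hwt', map_smul, hwy]
        rw [le_antisymm hle hge, norm_smul, Real.norm_of_nonneg hc.le, smul_smul]
        have : ‖y‖ / (‖y‖ / w S₀ * ‖y‖) * (‖y‖ / w S₀) = 1 := by
          field_simp
        rw [this, one_smul]

/-- The chain condition is closed: it says that `t q * t q' = 0` for incomparable `q`, `q'`. -/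
theorem isCompact_orderCone (a : A) : IsCompact (orderCone a) := by
  have h1 : orderCone a = stdSimplex ℝ A ∩ ((⋂ q, ⋂ q', ⋂ (_ : ¬ (q ≤ q' ∨ q' ≤ q)),
      {t : A → ℝ | t q * t q' = 0}) ∩ ⋂ q, ⋂ (_ : ¬ q ≤ a), {t : A → ℝ | t q = 0}) := by
    ext t
    simp only [mem_inter_iff, mem_iInter, mem_ofPred_eq, orderCone, stdSimplex, mul_eq_zero]
    constructor
    · rintro ⟨h0, h1, hc, hle⟩
      refine ⟨⟨h0, h1⟩, fun q q' hqq' => ?_, fun q hq => ?_⟩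
      · by_contra hne
        push Not at hne
        exact hqq' (hc.total hne.1 hne.2)
      · by_contra hne
        exact hq (hle q hne)
    · rintro ⟨⟨h0, h1⟩, hc, hle⟩
      refine ⟨h0, h1, fun q hq q' hq' _ => ?_, fun q hq => ?_⟩
      · by_contra hne
        rcases hc q q' hne with e | e
        · exact hq e
        · exact hq' e
      · by_contra hne
        exact hq (hle q hne)
  rw [h1]
  refine (isCompact_stdSimplex ℝ A).inter_right (IsClosed.inter ?_ ?_)
  · refine isClosed_iInter fun q => isClosed_iInter fun q' => isClosed_iInter fun _ => ?_
    exact isClosed_eq (by fun_prop) continuous_const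
  · refine isClosed_iInter fun q => isClosed_iInter fun _ => ?_
    exact isClosed_eq (by fun_prop) continuous_const

theorem exists_mem_orderCone_apply_ne_zero {t : A → ℝ} (ht : t ∈ orderCone a) :
    ∃ b ≤ a, t ∈ orderCone b ∧ t b ≠ 0 := by
  obtain ⟨h0, h1, hc, hle⟩ := ht
  have hne : (Finset.univ.filter fun q => t q ≠ 0).Nonempty := by
    by_contra hemp
    rw [Finset.not_nonempty_iff_eq_empty, Finset.filter_eq_empty_iff] at hemp
    rw [Finset.sum_eq_zero fun q hq => not_not.1 (hemp hq)] at h1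
    exact zero_ne_one h1
  obtain ⟨b, hb⟩ := Finset.exists_maximal hne
  have hb0 : t b ≠ 0 := by simpa using hb.1
  refine ⟨b, hle b hb0, ⟨h0, h1, hc, fun q hq => ?_⟩, hb0⟩
  rcases hc.total hq hb0 with e | e
  · exact e
  · exact hb.2 (by simpa using hq) e

theorem orderCone_mono {b : A} (hab : a ≤ b) : orderCone a ⊆ orderCone b :=
  fun _ ht => ⟨ht.1, ht.2.1, ht.2.2.1, fun q hq => (ht.2.2.2 q hq).trans hab⟩

/-- If all closed cells of the order complex are balls, then the order complex is a ball complex. -/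
theorem exists_isBallComplex_orderComplex (d : A → ℕ)
    (hchart : ∀ a, ∃ ρ : (A → ℝ) → (Fin (d a) → ℝ), ContinuousOn ρ (orderCone a) ∧
      InjOn ρ (orderCone a) ∧ ρ '' orderCone a = closedBall 0 1 ∧
      ∀ t ∈ orderCone a, ‖ρ t‖ = 1 - t a) :
    ∃ φ : ∀ a, (Fin (d a) → ℝ) → {t : A → ℝ // ∃ a, t ∈ orderCone a}, IsBallComplex d φ := by
  choose ρ hρc hρi hρim hρn using hchart
  set X := {t : A → ℝ // ∃ a, t ∈ orderCone a}
  have key : ∀ a, ∃ φ : (Fin (d a) → ℝ) → X, ContinuousOn φ (closedBall 0 1) ∧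
      InjOn φ (closedBall 0 1) ∧ (∀ y ∈ closedBall (0 : Fin (d a) → ℝ) 1,
        (φ y).1 ∈ orderCone a ∧ ‖y‖ = 1 - (φ y).1 a) ∧
      ∀ x : X, x.1 ∈ orderCone a → ∃ y ∈ closedBall (0 : Fin (d a) → ℝ) 1, φ y = x := by
    intro a
    have hcont := (hρc a).invFunOn_of_isCompact (isCompact_orderCone a) (hρi a)
    rw [hρim a] at hcont
    have hmem : ∀ y ∈ closedBall (0 : Fin (d a) → ℝ) 1,
        Function.invFunOn (ρ a) (orderCone a) y ∈ orderCone a ∧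
        ρ a (Function.invFunOn (ρ a) (orderCone a) y) = y := by
      intro y hy
      rw [← hρim a] at hy
      exact ⟨Function.invFunOn_mem hy, Function.invFunOn_eq hy⟩
    obtain ⟨y₀, hy₀⟩ : ∃ y, y ∈ closedBall (0 : Fin (d a) → ℝ) 1 := ⟨0, by simp⟩
    let x₀ : X := ⟨_, a, (hmem y₀ hy₀).1⟩
    let φ : (Fin (d a) → ℝ) → X := fun y => if hy : y ∈ closedBall 0 1 then
      ⟨Function.invFunOn (ρ a) (orderCone a) y, a, (hmem y hy).1⟩ else x₀
    have hφ : ∀ y ∈ closedBall (0 : Fin (d a) → ℝ) 1,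
        (φ y).1 = Function.invFunOn (ρ a) (orderCone a) y := by
      intro y hy
      simp only [φ, dif_pos hy]
    refine ⟨φ, ?_, ?_, ?_, ?_⟩
    · have hind : Topology.IsInducing (Subtype.val : X → (A → ℝ)) := Topology.IsInducing.subtypeVal
      rw [hind.continuousOn_iff]
      exact hcont.congr hφ
    · intro y hy y' hy' heq
      rw [← (hmem y hy).2, ← (hmem y' hy').2, ← hφ y hy, ← hφ y' hy', heq]
    · intro y hy
      rw [hφ y hy]
      refine ⟨(hmem y hy).1, ?_⟩
      rw [← hρn a _ (hmem y hy).1, (hmem y hy).2]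
    · intro x hx
      have hy : ρ a x.1 ∈ closedBall (0 : Fin (d a) → ℝ) 1 := by
        rw [← hρim a]
        exact mem_image_of_mem _ hx
      refine ⟨ρ a x.1, hy, Subtype.ext ?_⟩
      rw [hφ _ hy]
      exact (hρi a).leftInvOn_invFunOn hx
  choose φ hφc hφi hφm hφs using key
  have himg : ∀ a, φ a '' closedBall 0 1 = {x | x.1 ∈ orderCone a} := by
    intro a
    ext x
    constructor
    · rintro ⟨y, hy, rfl⟩
      exact (hφm a y hy).1
    · exact fun hx => hφs a x hx
  -- Interior points have `a` as the largest element of their support, which makes the interiors of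
  -- different cells disjoint.
  have hball : ∀ a, φ a '' ball 0 1 ⊆ {x | x.1 ∈ orderCone a ∧ x.1 a ≠ 0} := by
    rintro a _ ⟨y, hy, rfl⟩
    obtain ⟨h1, h2⟩ := hφm a y (ball_subset_closedBall hy)
    refine ⟨h1, fun h0 => ?_⟩
    rw [mem_ball_zero_iff, h2, h0, sub_zero] at hy
    exact lt_irrefl _ hy
  refine ⟨φ, hφc, hφi, ?_, ?_, ?_⟩
  · intro x
    obtain ⟨a, ha⟩ := x.2
    refine ⟨a, ?_⟩
    rw [himg]
    exact ha
  · intro a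
    simp only [himg]
    ext x
    simp only [mem_iUnion, exists_prop]
    constructor
    · rintro ⟨y, hy, rfl⟩
      obtain ⟨h1, h2⟩ := hφm a y (sphere_subset_closedBall hy)
      rw [mem_sphere_zero_iff_norm] at hy
      obtain ⟨b, hb, hxb, hb0⟩ := exists_mem_orderCone_apply_ne_zero h1
      refine ⟨b, lt_of_le_of_ne hb ?_, hxb⟩
      rintro rfl
      apply hb0
      linarith
    · rintro ⟨b, hb, hx⟩
      have hxa := orderCone_mono hb.le hx
      obtain ⟨y, hy, rfl⟩ := hφs a x hxa
      refine ⟨y, ?_, rfl⟩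
      have h0 : (φ a y).1 a = 0 := by
        by_contra hne
        exact absurd (hx.2.2.2 a hne) (not_le_of_gt hb)
      rw [mem_sphere_zero_iff_norm, (hφm a y hy).2, h0, sub_zero]
  · intro a b hab
    rw [disjoint_left]
    intro x hxa hxb
    have ha := hball a hxa
    have hb := hball b hxb
    exact hab (le_antisymm (hb.1.2.2.2 a ha.2) (ha.1.2.2.2 b hb.2))

end Charts

/-! ### Flags of upper sets and the existence of `CP_{n+1}` -/

section Existence

open Metric Set
open scoped Classical

section Flags

variable {α : Type*} [Fintype α]

/-- The non-empty proper upper sets of a relation. -/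
noncomputable def upperFlag (r : α → α → Prop) : Finset (Finset α) :=
  Finset.univ.filter fun S => S.Nonempty ∧ S ≠ Finset.univ ∧ ∀ i ∈ S, ∀ j, r i j → j ∈ S

theorem mem_upperFlag {r : α → α → Prop} {S : Finset α} :
    S ∈ upperFlag r ↔ S.Nonempty ∧ S ≠ Finset.univ ∧ ∀ i ∈ S, ∀ j, r i j → j ∈ S := by
  simp [upperFlag]

theorem upperFlag_subset_iff {r r' : TotalPreorder α} :
    upperFlag r'.1 ⊆ upperFlag r.1 ↔ r ≤ r' := by
  constructor
  · intro h i j hij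
    by_contra hn
    -- The upper set generated by `i` is proper because it misses `j`; being also an upper set for
    -- `r`, it contradicts `r i j`.
    have hS : (Finset.univ.filter fun k => r'.1 i k) ∈ upperFlag r'.1 := by
      rw [mem_upperFlag]
      refine ⟨⟨i, by simpa using r'.refl i⟩, fun hu => ?_, fun k hk l hkl => ?_⟩
      · have : j ∈ Finset.univ.filter fun k => r'.1 i k := by
          rw [hu]
          exact Finset.mem_univ j
        exact hn (by simpa using this)
      · simp only [Finset.mem_filter, Finset.mem_univ, true_and] at hk ⊢
        exact r'.2.2 _ _ _ hk hkl
    have := (mem_upperFlag.1 (h hS)).2.2 i (by simpa using r'.refl i) j hij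
    exact hn (by simpa using this)
  · intro h S hS
    rw [mem_upperFlag] at hS ⊢
    exact ⟨hS.1, hS.2.1, fun i hi j hij => hS.2.2 i hi j (h i j hij)⟩

theorem isChain_upperFlag (r : TotalPreorder α) :
    IsChain (· ≤ ·) (upperFlag r.1 : Set (Finset α)) := by
  intro S hS T hT _
  have hS := (mem_upperFlag.1 hS).2.2
  have hT := (mem_upperFlag.1 hT).2.2
  by_contra hcon
  push Not at hcon
  obtain ⟨i, hiS, hiT⟩ := Finset.not_subset.1 hcon.1
  obtain ⟨j, hjT, hjS⟩ := Finset.not_subset.1 hcon.2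
  rcases r.2.1 i j with e | e
  · exact hjS (hS i hiS j e)
  · exact hiT (hT j hjT i e)

/-- Let `i` precede `j` when every member of `C` containing `i` contains `j`. An upper set outside
`C` is ruled out by `exists_not_separated`. -/
theorem exists_upperFlag_eq {C : Finset (Finset α)} (hne : ∀ S ∈ C, S.Nonempty)
    (hu : ∀ S ∈ C, S ≠ Finset.univ) (hC : IsChain (· ≤ ·) (C : Set (Finset α))) :
    ∃ r : TotalPreorder α, upperFlag r.1 = C := by
  refine ⟨⟨fun i j => ∀ S ∈ C, i ∈ S → j ∈ S, fun i j => ?_,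
    fun i j k h1 h2 S hS hi => h2 S hS (h1 S hS hi)⟩, ?_⟩
  · by_contra hcon
    push Not at hcon
    obtain ⟨⟨S, hS, hiS, hjS⟩, T, hT, hjT, hiT⟩ := hcon
    rcases hC.total hS hT with e | e
    · exact hiT (e hiS)
    · exact hjS (e hjT)
  · ext S
    rw [mem_upperFlag]
    constructor
    · rintro ⟨h1, h2, h3⟩
      by_contra hS
      obtain ⟨i, hi, j, hj, hij⟩ := IsFlagLabeling.exists_not_separated hC hS h1 h2
      exact hj (h3 i hi j hij)
    · exact fun hS => ⟨hne S hS, hu S hS, fun i hi j hij => hij S hS hi⟩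

end Flags

section CWStructure

open Topology

variable {n : ℕ} {X : Type} [TopologicalSpace X] {φ : ∀ a : CPCell n, (Fin a.dim → ℝ) → X}

theorem IsBallComplex.subset_iff {A Y : Type*} [PartialOrder A] [Finite A] [TopologicalSpace Y]
    {d : A → ℕ} {ψ : ∀ a, (Fin (d a) → ℝ) → Y} (h : IsBallComplex d ψ) {a b : A} :
    ψ a '' closedBall 0 1 ⊆ ψ b '' closedBall 0 1 ↔ a ≤ b := by
  constructor
  · intro hab
    have h0 : ψ a 0 ∈ ψ a '' ball 0 1 := mem_image_of_mem _ (by simp)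
    obtain ⟨c, hc, hc0⟩ := h.exists_mem_image_ball b (hab (image_mono ball_subset_closedBall h0))
    by_contra hn
    have hne : a ≠ c := by
      rintro rfl
      exact hn hc
    exact disjoint_left.1 (h.disjoint a c hne) h0 hc0
  · intro hab
    rcases hab.eq_or_lt with rfl | hlt
    · exact Subset.rfl
    · refine Subset.trans ?_ (image_mono (sphere_subset_closedBall (x := 0) (ε := 1)))
      rw [h.boundary b]
      exact subset_biUnion_of_mem (u := fun a => ψ a '' closedBall 0 1) hlt

/-- The CW structure of a ball complex whose cells are indexed by the labels of `CP_{n+1}`. -/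
@[reducible]
noncomputable def IsBallComplex.cwComplex [T2Space X] (h : IsBallComplex CPCell.dim φ) :
    CWComplex (univ : Set X) :=
  CWComplex.mkFiniteType univ (CPLabel n)
    (fun k i => ((h.injOn ⟨k, i⟩).mono ball_subset_closedBall).toPartialEquiv _ _)
    (fun k => Finite.of_injective (fun i : CPLabel n k => (⟨k, i⟩ : CPCell n))
      fun i j hij => by simpa using hij)
    (fun _ _ => rfl)
    (fun k i => h.continuousOn ⟨k, i⟩)
    (fun k i => by
      refine ContinuousOn.of_comp_of_isCompact (isCompact_closedBall 0 1) (h.continuousOn ⟨k, i⟩)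
        (h.injOn ⟨k, i⟩) (fun y hy => ball_subset_closedBall (Function.invFunOn_mem hy)) ?_
      exact continuousOn_id.congr fun y hy => Function.invFunOn_eq hy)
    (fun p _ q _ hpq => h.disjoint ⟨p.1, p.2⟩ ⟨q.1, q.2⟩ fun e => hpq (by
      obtain ⟨k, i⟩ := p
      obtain ⟨l, j⟩ := q
      simp only [CPCell.mk.injEq] at e
      exact Sigma.ext e.1 e.2))
    (fun k i y hy => by
      have hy' : φ ⟨k, i⟩ y ∈ φ ⟨k, i⟩ '' sphere 0 1 := mem_image_of_mem _ hy
      rw [h.boundary] at hy'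
      simp only [mem_iUnion] at hy' ⊢
      obtain ⟨b, hb, hyb⟩ := hy'
      exact ⟨b.dim, CPCell.dim_lt_of_lt hb, b.label, hyb⟩)
    (fun S _ hS => by
      have hU : S = ⋃ a : CPCell n, S ∩ φ a '' closedBall 0 1 := by
        rw [← inter_iUnion, eq_comm, inter_eq_left]
        exact fun x _ => mem_iUnion.2 (h.cover x)
      rw [hU]
      exact isClosed_iUnion_of_finite fun a => hS a.dim a.label)
    (by
      rw [eq_univ_iff_forall]
      intro x
      obtain ⟨a, ha⟩ := h.cover x
      exact mem_iUnion₂.2 ⟨a.dim, a.label, ha⟩)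

/-- A ball complex whose cells are indexed by the labels of `CP_{n+1}` is a complex `CP_{n+1}`. -/
noncomputable def IsBallComplex.cpComplex [T2Space X] (h : IsBallComplex CPCell.dim φ) :
    letI := h.cwComplex
    CPComplex n X :=
  letI := h.cwComplex
  { regular :=
      { t2 := inferInstance
        finite := Finite.of_injective
          (fun p : Σ k, CPLabel n k => (⟨p.1, p.2⟩ : CPCell n)) (by
            rintro ⟨k, i⟩ ⟨l, j⟩ e
            simp only [CPCell.mk.injEq] at e
            exact Sigma.ext e.1 e.2)
        injOn := fun k i => h.injOn ⟨k, i⟩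
        frontier_eq := fun k i => by
          refine ⟨{p | (⟨p.1, p.2⟩ : CPCell n) < ⟨k, i⟩}, fun p hp => CPCell.dim_lt_of_lt hp, ?_⟩
          refine (h.boundary ⟨k, i⟩).trans ?_
          ext x
          simp only [mem_iUnion]
          constructor
          · rintro ⟨b, hb, hx⟩
            exact ⟨⟨b.dim, b.label⟩, hb, hx⟩
          · rintro ⟨p, hp, hx⟩
            exact ⟨⟨p.1, p.2⟩, hp, hx⟩ }
    label := fun k => Equiv.refl _
    incidence := fun k l i j => h.subset_iff (a := ⟨l, j⟩) (b := ⟨k, i⟩) }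

end CWStructure

/-- Cut the label of `a` open; each refinement is then a total preorder and is labeled by its flag
of upper sets. The map `π` gives the position of the part of `a` containing an element. -/
theorem CPCell.exists_isFlagLabeling {n : ℕ} (a : CPCell n) :
    ∃ (m : ℕ) (G : CPCell n → Finset (Finset (Fin (n + 1)))) (π : Fin (n + 1) → Fin m),
      IsFlagLabeling a G π ∧ Function.Surjective π ∧ a.dim + m = n + 1 := by
  obtain ⟨I, hI⟩ := a.label.1.exists_coe_eq
  obtain ⟨s, hs⟩ := a.label.1.exists_ordersBy hI
  have hlen : a.label.1.numParts = I.length := by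
    rw [CyclicPartition.numParts, hI, Cycle.length_coe]
  have h3 := a.label.2.1
  have hdim := a.label.2.2
  obtain ⟨b, hb, hbs⟩ := hs.exists_index
  let e := (CyclicPartition.refinementIso hI (by omega) hs).symm
  let G : CPCell n → Finset (Finset (Fin (n + 1))) := fun q =>
    if h : q ≤ a then upperFlag (e ⟨q.label.1, h⟩).1.1 else ∅
  have hG : ∀ q (h : q ≤ a), G q = upperFlag (e ⟨q.label.1, h⟩).1.1 := fun q h => dif_pos h
  -- The isomorphism matches the greatest elements, so the flag of `a` is that of `s`.
  have htop : (e ⟨a.label.1, le_rfl⟩).1 = s := by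
    refine le_antisymm (e ⟨a.label.1, le_rfl⟩).2 ?_
    have h1 : e.symm ⟨s, le_rfl⟩ ≤ ⟨a.label.1, le_rfl⟩ := (e.symm ⟨s, le_rfl⟩).2
    exact e.symm_apply_le.1 h1
  have hGa : G a = upperFlag s.1 := by rw [hG a le_rfl, htop]
  refine ⟨I.length, G, b, ⟨?_, ?_, ?_, ?_, ?_, ?_⟩, ?_, by omega⟩
  · intro q hq q' hq'
    rw [hG q hq, hG q' hq', upperFlag_subset_iff]
    exact (e.le_iff_le (x := ⟨q.label.1, hq⟩) (y := ⟨q'.label.1, hq'⟩)).symm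
  · intro q hq S hS
    rw [hG q hq, mem_upperFlag] at hS
    exact hS.1
  · intro q hq S hS
    rw [hG q hq, mem_upperFlag] at hS
    exact hS.2.1
  · intro q hq
    rw [hG q hq]
    exact isChain_upperFlag _
  · intro C haC hne hu hC
    obtain ⟨r, rfl⟩ := exists_upperFlag_eq hne hu hC
    have hrs : r ≤ s := by
      rw [← upperFlag_subset_iff, ← hGa]
      exact haC
    obtain ⟨q, hq⟩ := CPCell.exists_of_le (b := a) (e.symm ⟨r, hrs⟩).2
    have hqa : q ≤ a := by
      rw [CPCell.le_iff, hq]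
      exact (e.symm ⟨r, hrs⟩).2
    refine ⟨q, hqa, ?_⟩
    have h1 : (⟨q.label.1, hqa⟩ : {p // p ≤ a.label.1}) = e.symm ⟨r, hrs⟩ := Subtype.ext hq
    rw [hG q hqa, h1, OrderIso.apply_symm_apply]
  · intro S
    rw [hGa, mem_upperFlag]
    simp only [hbs]
  · intro j
    obtain ⟨i, hi⟩ := hs.nonempty (I.get j) (List.get_mem _ _)
    exact ⟨i, (hb i j).1 hi⟩

theorem exists_cpComplex (n : ℕ) :
    ∃ (X : Type) (_ : TopologicalSpace X) (_ : Topology.CWComplex (univ : Set X)),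
      Nonempty (CPComplex n X) := by
  have := Fintype.ofFinite (CPCell n)
  obtain ⟨φ, hφ⟩ := exists_isBallComplex_orderComplex (CPCell.dim (n := n)) fun a => by
    obtain ⟨m, G, π, h, hπ, hm⟩ := a.exists_isFlagLabeling
    exact h.exists_chart hπ (by simpa using hm)
  exact ⟨_, inferInstance, hφ.cwComplex, ⟨hφ.cpComplex⟩⟩

end Existence

theorem proposition1 (n : ℕ) (hn : 3 ≤ n) :
    -- existence
    (∃ (X : Type) (_ : TopologicalSpace X) (_ : Topology.CWComplex (Set.univ : Set X)),
      Nonempty (CPComplex n X)) ∧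
    -- uniqueness up to a homeomorphism that preserves the labeled cells
    (∀ (X : Type*) [TopologicalSpace X] [Topology.CWComplex (Set.univ : Set X)]
      (Y : Type*) [TopologicalSpace Y] [Topology.CWComplex (Set.univ : Set Y)]
      (K : CPComplex n X) (L : CPComplex n Y),
      ∃ h : X ≃ₜ Y, ∀ (k : ℕ) (p : CPLabel n k), h '' K.closedCell p = L.closedCell p) ∧
    -- each closed cell is combinatorially equivalent to a product of permutohedra
    (∀ (X : Type*) [TopologicalSpace X] [Topology.CWComplex (Set.univ : Set X)]
      (K : CPComplex n X) (k : ℕ) (p : CPLabel n k) (I : List (Finset (Fin (n + 1)))),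
      p.1.parts = (I : Cycle (Finset (Fin (n + 1)))) →
      Nonempty (K.CellsIn p ≃o Faces (permutohedronProd fun j : Fin I.length => (I.get j).card))) := by
  refine ⟨exists_cpComplex n, fun X _ _ Y _ _ K L => K.exists_homeomorph L,
    fun X _ _ K k p I hI => ?_⟩
  obtain ⟨s, hs⟩ := p.1.exists_ordersBy hI
  have hlen : 2 ≤ I.length := by
    have h1 := p.2.1
    rw [CyclicPartition.numParts, hI, Cycle.length_coe] at h1
    omega
  exact ⟨((K.cellsInIso p).symm.trans (CyclicPartition.refinementIso hI hlen hs).symm).trans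
    (facesIso hs)⟩
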